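/- **Setting.** Consider $M$ agents with dynamics $\dot x_i=f_i(x_i,t)+g_i(x_i,t)u_i+c_i(x,t)$, $x_i\in\mathbb R^{n_i}$, $u_i\in\mathbb R^{m_i}$, $x=(x_1,\dots,x_M)$, $t\ge 0$, where $f_i,g_i,c_i$ are locally Lipschitz in the state and measurable in $t$, $g_i$ has full row rank everywhere, and $\|c_i(x,t)\|\le C$. The agents are partitioned into groups $\mathcal V_1,\dots,\mathcal V_K$, each of which is a clique of the undirected communication graph; $\bar x_k\in\mathbb R^{\bar n_k}$ stacks the states of the agents in $\mathcal V_k$. Group $k$ is given a formula $\phi_k$ over $\bar x_k$ of the signal temporal logic fragment $$\psi::=\top\mid\mu\mid\neg\mu\mid\psi'\wedge\psi'',\qquad \phi::=G_{[a,b]}\psi\mid F_{[a,b]}\psi\mid\psi'\,U^{c}_{[a,b]}\psi''\mid\phi'\wedge\phi''$$ with $0\le c\le a\le b<\infty$. Its robust semantics are $\rho^{\top}=+\infty$; $\rho^\mu(x,t)=h(x(t))$ and $\rho^{\neg\mu}=-\rho^{\mu}$ for a predicate $\mu$ with predicate function $h$; minimum for $\wedge$; minimum (maximum) of $\rho^\psi(x,\cdot)$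 over $[t+a,t+b]$ for $G_{[a,b]}\psi$ (for $F_{[a,b]}\psi$); and $$\rho^{\psi'U^c_{[a,b]}\psi''}(x,t)=\max_{\bar t\in[t+a,t+b]}\min\Big(\rho^{\psi''}(x,\bar t),\min_{\underline t\in[t+c,\bar t]}\rho^{\psi'}(x,\underline t)\Big).$$ ($c=0$ and $c=a$ are the two usual conventions for until.) Each $\phi_k$ is encoded by operators $G_{[a_l,b_l]}\mu_l$ and $F_{[a_l,b_l]}\mu_l$, $l=1,\dots,p$, by splitting conjunctions and replacing $\psi'U^c_{[a,b]}\psi''$ by $G_{[c,b]}\psi'\wedge F_{[b,b]}\psi''$. The predicate function of $\mu_l$ is denoted by $h_l$, with $-h$ taken for a negated predicate. Assume that all $h_l$ are continuously differentiable and concave. **Barrier functions** (index $k$ omitted). Let $t_l^*=a_l$ for an always- and $t_l^*=b_l$ for an eventually-operator, $\gamma_l(t)=(\gamma_{l,0}-\gamma_{l,\infty})e^{-\mathfrak l_lt}+\gamma_{l,\infty}$, $\mathfrak b_l(\bar x,t)=h_l(\bar x)-\gamma_l(t)$ for $l\le p$ and $\mathfrak b_{p+1}(\bar x)=D-\sqrt{\varepsilon^2+\|\bar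 x\|^2}$ with $\varepsilon\ge0$. Let $\mathfrak o_l(t)=1$ if $t<b_l$, $\mathfrak o_l(t)=0$ if $t\ge b_l$, $\mathfrak o_{p+1}\equiv1$, and $$\mathfrak b(\bar x,t)=-\tfrac1\eta\ln\Big(\sum_{l=1}^{p+1}\mathfrak o_l(t)e^{-\eta\mathfrak b_l(\bar x,t)}\Big).$$ Let $0=s_0<s_1<\dots<s_q$ be $0$ followed by the distinct positive $b_l$ in increasing order. Fix an initial state $x(0)$ and $\delta>0$. Let $(\eta,r,D,\gamma_{l,0},\gamma_{l,\infty},\mathfrak l_l,\xi_1,\dots,\xi_q)$ be a feasible point of the offline parameter selection problem (whose objective is to maximize $r$), with constraints $\mathfrak b(\bar x(0),0)\ge\delta$; $\lim_{\tau\to s_j^-}\mathfrak b(\xi_j,\tau)\ge\delta$ for $j=1,\dots,q$; $\gamma_{l,0}<h_l(\bar x(0))$, and also $\gamma_{l,0}\ge r$ if $t_l^*=0$; $\max(r,\gamma_{l,0})<\gamma_{l,\infty}<\sup h_l$; $\mathfrak l_l=-\ln\big(\tfrac{r-\gamma_{l,\infty}}{\gamma_{l,0}-\gamma_{l,\infty}}\big)/t_l^*$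 if $\gamma_{l,0}<r$ and $\mathfrak l_l=0$ otherwise; $\eta>0$; $r>0$. Let $\mathfrak b^{\max}$ be an upper bound of all active functions ($\mathfrak b_{p+1}$ and those $\mathfrak b_l$ with $\mathfrak o_l(t)=1$) at the maximizers of $\mathfrak b(\cdot,t)$, for all $t\in[0,s_q)$. Put $\Delta_l=\mathfrak l_l(\gamma_{l,\infty}-\gamma_{l,0})$, $\zeta_l=-e^{-\eta\delta}\Delta_l/e^{-\eta\mathfrak b^{\max}}$, and let $\alpha(s)=\kappa s$ with $\kappa>0$ and $\kappa>-\zeta_l/\delta$ for all $l\le p$. **Control law.** For each $k$ let $\mathfrak D_k$ be an open set containing $\{\bar x_k:\mathfrak b^k(\bar x_k,t)\ge0\}$ for all $t\in[0,s^k_{q_k})$. At every $(\bar x_k,t)\in\mathfrak D_k\times(s^k_j,s^k_{j+1})$, $0\le j<q_k$, at which $\mathfrak b^k(\cdot,t)$ is differentiable, each agent $i\in\mathcal V_k$ applies an input $u_i$ that minimizes $u_i^Tu_i$ subject to $$\frac{\partial\mathfrak b^k}{\partial x_i}\big(f_i+g_iu_i\big)\ge\Big\|\frac{\partial\mathfrak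 b^k}{\partial x_i}\Big\|\hat n_kC-\mathfrak N_i\Big(\frac{\partial\mathfrak b^k}{\partial t}+\alpha_k(\mathfrak b^k)\Big),\qquad\hat n_k=\sqrt{\bar n_k\max(n_1,\dots,n_M)},$$ where $\mathfrak N_i=\|\partial\mathfrak b^k/\partial x_i\|\big/\sum_{d\in\mathcal V_k}\|\partial\mathfrak b^k/\partial x_d\|$ if the denominator is nonzero and $\mathfrak N_i=1$ otherwise. Elsewhere $u_i(\bar x_k,t)$ is arbitrary. **Claim.** Let $x:[0,T]\to\mathbb R^n$ be any Filippov solution of the closed-loop system with the given initial state $x(0)$, and let $k$ be such that all $b_l$ of $\phi_k$ are at most $T$. If $\varepsilon_k=0$, assume also that $\bar x_k(t)\ne0$ for almost all $t\in[0,T]$. Then $$\rho^{\phi_k}(\bar x_k,0)\ge r_k>0 .$$ -/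

import Mathlib

open Set Filter Topology MeasureTheory

noncomputable section

/-! ### Signal temporal logic: the considered fragment and its robust semantics -/

/-- Formulas `ψ ::= ⊤ | μ | ¬μ | ψ' ∧ ψ''` without temporal operators. A predicate `μ` is given by
its predicate function `h`; `npred h` is the negation of that predicate. -/
inductive StateFormula (E : Type) : Type
  | top : StateFormula E
  | pred (h : E → ℝ) : StateFormula E
  | npred (h : E → ℝ) : StateFormula E
  | conj (ψ₁ ψ₂ : StateFormula E) : StateFormula E

/-- Formulas `φ ::= G_[a,b] ψ | F_[a,b] ψ | ψ' U_[a,b] ψ'' | φ' ∧ φ''`. The until operator carries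
the time offset `c ≤ a` from which its left argument has to hold: `c = 0` ("from now on") and
`c = a` ("from the beginning of the interval `[a,b]` on") are the two usual conventions. -/
inductive TemporalFormula (E : Type) : Type
  | always (a b : ℝ) (ha : 0 ≤ a) (hab : a ≤ b) (ψ : StateFormula E) : TemporalFormula E
  | eventually (a b : ℝ) (ha : 0 ≤ a) (hab : a ≤ b) (ψ : StateFormula E) : TemporalFormula E
  | untl (c a b : ℝ) (hc : 0 ≤ c) (hca : c ≤ a) (hab : a ≤ b) (ψ₁ ψ₂ : StateFormula E) :
      TemporalFormula E
  | conj (φ₁ φ₂ : TemporalFormula E) : TemporalFormula E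

/-- Robust semantics of the non-temporal formulas (the robustness of `⊤` is `+∞`). -/
def StateFormula.robustness {E : Type} (x : ℝ → E) : StateFormula E → ℝ → EReal
  | .top, _ => ⊤
  | .pred h, t => ((h (x t) : ℝ) : EReal)
  | .npred h, t => ((-h (x t) : ℝ) : EReal)
  | .conj ψ₁ ψ₂, t => min (ψ₁.robustness x t) (ψ₂.robustness x t)

/-- Robust semantics of the temporal formulas. -/
def TemporalFormula.robustness {E : Type} (x : ℝ → E) : TemporalFormula E → ℝ → EReal
  | .always a b _ _ ψ, t => ⨅ t' ∈ Icc (t + a) (t + b), ψ.robustness x t'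
  | .eventually a b _ _ ψ, t => ⨆ t' ∈ Icc (t + a) (t + b), ψ.robustness x t'
  | .untl c a b _ _ _ ψ₁ ψ₂, t =>
      ⨆ t' ∈ Icc (t + a) (t + b),
        min (ψ₂.robustness x t') (⨅ t'' ∈ Icc (t + c) t', ψ₁.robustness x t'')
  | .conj φ₁ φ₂, t => min (φ₁.robustness x t) (φ₂.robustness x t)

/-! ### Decomposition of a formula into single always- and eventually-operators -/

/-- The predicate functions of a non-temporal formula (`-h` for a negated predicate). -/
def StateFormula.predicates {E : Type} : StateFormula E → List (E → ℝ)
  | .top => []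
  | .pred h => [h]
  | .npred h => [fun x => -h x]
  | .conj ψ₁ ψ₂ => ψ₁.predicates ++ ψ₂.predicates

/-- A single operator `G_[a,b] μ` (if `isAlways`) or `F_[a,b] μ`, with predicate function `h`. -/
structure STLTask (E : Type) : Type where
  isAlways : Bool
  a : ℝ
  b : ℝ
  h : E → ℝ

/-- The always- and eventually-operators encoding `φ`; `ψ₁ U_[a,b] ψ₂` is encoded as
`G_[c,b] ψ₁ ∧ F_[b,b] ψ₂`. -/
def TemporalFormula.tasks {E : Type} : TemporalFormula E → List (STLTask E)
  | .always a b _ _ ψ => ψ.predicates.map fun h => ⟨true, a, b, h⟩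
  | .eventually a b _ _ ψ => ψ.predicates.map fun h => ⟨false, a, b, h⟩
  | .untl c _ b _ _ _ ψ₁ ψ₂ =>
      (ψ₁.predicates.map fun h => ⟨true, c, b, h⟩) ++
        ψ₂.predicates.map fun h => ⟨false, b, b, h⟩
  | .conj φ₁ φ₂ => φ₁.tasks ++ φ₂.tasks

/-- The number `p` of operators. -/
def TemporalFormula.numTasks {E : Type} (φ : TemporalFormula E) : ℕ := φ.tasks.length

/-- The `l`-th operator. -/
def TemporalFormula.task {E : Type} (φ : TemporalFormula E) (l : Fin φ.numTasks) : STLTask E :=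
  φ.tasks.get l

/-- The time `t*`: `a` for an always-operator, `b` for an eventually-operator. -/
def STLTask.tStar {E : Type} (τ : STLTask E) : ℝ := if τ.isAlways then τ.a else τ.b

/-- The set of positive switching times, i.e. of the positive end points `b_l`. -/
def TemporalFormula.switchTimes {E : Type} (φ : TemporalFormula E) : Finset ℝ :=
  (φ.tasks.map fun τ => τ.b).toFinset.filter fun s => 0 < s

/-- The number `q` of switches. -/
def TemporalFormula.numSwitches {E : Type} (φ : TemporalFormula E) : ℕ := φ.switchTimes.card

/-- The switching sequence `0 = s_0 < s_1 < ... < s_q`. -/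
def TemporalFormula.switchSeq {E : Type} (φ : TemporalFormula E) :
    Fin (φ.numSwitches + 1) → ℝ :=
  Fin.cons 0 (φ.switchTimes.orderEmbOfFin rfl)

/-! ### The barrier function and the offline parameter selection -/

/-- The decision variables of the parameter selection problem for `φ`. -/
structure BarrierParams {E : Type} (φ : TemporalFormula E) : Type where
  η : ℝ
  r : ℝ
  D : ℝ
  γ₀ : Fin φ.numTasks → ℝ
  γinf : Fin φ.numTasks → ℝ
  rate : Fin φ.numTasks → ℝ
  ξ : Fin φ.numSwitches → E

section Barrier

variable {E : Type} [NormedAddCommGroup E] {φ : TemporalFormula E}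

/-- `γ_l(t) = (γ_{l,0} - γ_{l,∞}) exp(-𝔩_l t) + γ_{l,∞}`. -/
def BarrierParams.gamma (P : BarrierParams φ) (l : Fin φ.numTasks) (t : ℝ) : ℝ :=
  (P.γ₀ l - P.γinf l) * Real.exp (-P.rate l * t) + P.γinf l

/-- `𝔟_l(x,t) = -γ_l(t) + h_l(x)` for `l ≤ p`. -/
def BarrierParams.taskBarrier (P : BarrierParams φ) (l : Fin φ.numTasks) (x : E) (t : ℝ) : ℝ :=
  -P.gamma l t + (φ.task l).h x

/-- `𝔟_{p+1}(x) = D - √(ε² + ‖x‖²)`; this is `D - ‖x‖` for `ε = 0`. -/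
def BarrierParams.boundBarrier (P : BarrierParams φ) (ε : ℝ) (x : E) : ℝ :=
  P.D - Real.sqrt (ε ^ 2 + ‖x‖ ^ 2)

/-- The switch `𝔬_l(t)`, which removes `𝔟_l` at `t = b_l`. -/
def TemporalFormula.switch (φ : TemporalFormula E) (l : Fin φ.numTasks) (t : ℝ) : ℝ :=
  if t < (φ.task l).b then 1 else 0

/-- `𝔟(x,t) = -(1/η) ln (∑_l 𝔬_l(t) exp(-η 𝔟_l(x,t)))`, the sum including `𝔟_{p+1}`. -/
def BarrierParams.barrier (P : BarrierParams φ) (ε : ℝ) (x : E) (t : ℝ) : ℝ :=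
  -(1 / P.η) * Real.log
    (∑ l, φ.switch l t * Real.exp (-P.η * P.taskBarrier l x t)
      + Real.exp (-P.η * P.boundBarrier ε x))

/-- `h^opt = sup_x h(x)`, possibly `+∞`. -/
def STLTask.hOpt (τ : STLTask E) : EReal := ⨆ x : E, ((τ.h x : ℝ) : EReal)

/-- The constraints of the parameter selection problem, with margin `δ` and initial state `x₀`. -/
structure BarrierParams.IsFeasible (P : BarrierParams φ) (ε δ : ℝ) (x₀ : E) : Prop where
  initial : δ ≤ P.barrier ε x₀ 0
  switching : ∀ j : Fin φ.numSwitches, ∃ L : ℝ,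
    Tendsto (fun t => P.barrier ε (P.ξ j) t) (𝓝[<] (φ.switchSeq j.succ)) (𝓝 L) ∧ δ ≤ L
  gamma_zero : ∀ l, P.γ₀ l < (φ.task l).h x₀ ∧ (¬ 0 < (φ.task l).tStar → P.r ≤ P.γ₀ l)
  gamma_inf : ∀ l, max P.r (P.γ₀ l) < P.γinf l ∧ ((P.γinf l : ℝ) : EReal) < (φ.task l).hOpt
  rate_eq : ∀ l, P.rate l =
    if P.γ₀ l < P.r then
      -Real.log ((P.r - P.γinf l) / (P.γ₀ l - P.γinf l)) / (φ.task l).tStar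
    else 0
  eta_pos : 0 < P.η
  r_pos : 0 < P.r

/-- `𝔟max` bounds the active functions `𝔟_1, ..., 𝔟_{p+1}` from above at all maximizers of
`𝔟(·,t)`, for every `t ∈ [s_0, s_q)`. -/
def BarrierParams.IsMaxBound (P : BarrierParams φ) (ε bmax : ℝ) : Prop :=
  ∀ t ∈ Ico 0 (φ.switchSeq (Fin.last _)), ∀ x : E,
    (∀ y : E, P.barrier ε y t ≤ P.barrier ε x t) →
      P.boundBarrier ε x ≤ bmax ∧
      ∀ l, t < (φ.task l).b → P.taskBarrier l x t ≤ bmax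

/-- `Δ_l = sup_{t ≥ 0} |∂𝔟_l/∂t| = 𝔩_l (γ_{l,∞} - γ_{l,0})`. -/
def BarrierParams.Delta (P : BarrierParams φ) (l : Fin φ.numTasks) : ℝ :=
  P.rate l * (P.γinf l - P.γ₀ l)

/-- `ζ_l = -exp(-η δ) Δ_l / exp(-η 𝔟max)`. -/
def BarrierParams.zeta (P : BarrierParams φ) (δ bmax : ℝ) (l : Fin φ.numTasks) : ℝ :=
  -Real.exp (-P.η * δ) * P.Delta l / Real.exp (-P.η * bmax)

end Barrier

/-! ### Filippov solutions -/

section Filippov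

variable {X : Type} [NormedAddCommGroup X] [InnerProductSpace ℝ X] [FiniteDimensional ℝ X]
  [MeasurableSpace X] [BorelSpace X]

/-- The Filippov set-valued map: the closed convex hull of the limits `lim F(y_i, t)` along
sequences `y_i → x` that avoid an arbitrary Lebesgue null set `N`. -/
def filippovMap (F : X → ℝ → X) (x : X) (t : ℝ) : Set X :=
  ⋂ (N : Set X) (_ : volume N = 0),
    closedConvexHull ℝ {v : X | ∃ y : ℕ → X, Tendsto y atTop (𝓝 x) ∧ (∀ i, y i ∉ N) ∧
      Tendsto (fun i => F (y i) t) atTop (𝓝 v)}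

/-- `x : [t₀,t₁] → X` is a Filippov solution of `ẋ = F(x,t)`. -/
def IsFilippovSolution (F : X → ℝ → X) (x : ℝ → X) (t₀ t₁ : ℝ) : Prop :=
  AbsolutelyContinuousOnInterval x t₀ t₁ ∧
    ∀ᵐ t ∂(volume.restrict (Icc t₀ t₁)), ∃ v ∈ filippovMap F (x t) t, HasDerivAt x v t

end Filippov

/-! ### Coupled multi-agent systems -/

/-- The state of all agents, `x_i ∈ ℝ^{n_i}`, with the Euclidean norm. -/
abbrev FullState {M : ℕ} (n : Fin M → ℕ) : Type :=
  PiLp 2 fun i : Fin M => EuclideanSpace ℝ (Fin (n i))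

/-- The stacked state `x̄_k` of the agents in `𝒱_k = {i | grp i = k}`, with the Euclidean norm. -/
abbrev GroupState {M K : ℕ} (n : Fin M → ℕ) (grp : Fin M → Fin K) (k : Fin K) : Type :=
  PiLp 2 fun i : {i : Fin M // grp i = k} => EuclideanSpace ℝ (Fin (n i))

/-- The projection `x ↦ x̄_k`. -/
def groupState {M K : ℕ} {n : Fin M → ℕ} (grp : Fin M → Fin K) (k : Fin K) (x : FullState n) :
    GroupState n grp k :=
  WithLp.toLp 2 fun i => x i.1

/-- Locally Lipschitz continuous in the state and measurable in time (for times `t ≥ 0`). -/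
def SufficientlyRegular {X Y : Type} [PseudoEMetricSpace X] [PseudoEMetricSpace Y]
    [MeasurableSpace Y] (f : X → ℝ → Y) : Prop :=
  (∀ t, 0 ≤ t → LocallyLipschitz fun x => f x t) ∧
    ∀ x, Measurable fun t : Ici (0 : ℝ) => f x t

/-- `M` agents with dynamics `ẋ_i = f_i(x_i,t) + g_i(x_i,t) u_i + c_i(x,t)`, and a bound `C` on the
`c_i`. -/
structure MultiAgentSystem (M : ℕ) : Type where
  n : Fin M → ℕ
  m : Fin M → ℕ
  f : ∀ i, EuclideanSpace ℝ (Fin (n i)) → ℝ → EuclideanSpace ℝ (Fin (n i))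
  g : ∀ i, EuclideanSpace ℝ (Fin (n i)) → ℝ → Matrix (Fin (n i)) (Fin (m i)) ℝ
  c : ∀ i, FullState n → ℝ → EuclideanSpace ℝ (Fin (n i))
  C : ℝ

namespace MultiAgentSystem

variable {M K : ℕ} (S : MultiAgentSystem M)

/-- The standing assumptions on the dynamics: sufficient regularity, boundedness of the `c_i`, and
full row rank of the `g_i`. -/
structure Admissible : Prop where
  f_regular : ∀ i, SufficientlyRegular (S.f i)
  g_regular : ∀ i a b, SufficientlyRegular fun y t => S.g i y t a b
  c_regular : ∀ i, SufficientlyRegular (S.c i)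
  C_nonneg : 0 ≤ S.C
  c_bound : ∀ i x t, 0 ≤ t → ‖S.c i x t‖ ≤ S.C
  g_rank : ∀ i y t, 0 ≤ t → (S.g i y t).rank = S.n i

/-- The product `g_i(x_i,t) u_i`. -/
def input (i : Fin M) (y : EuclideanSpace ℝ (Fin (S.n i))) (t : ℝ)
    (u : EuclideanSpace ℝ (Fin (S.m i))) : EuclideanSpace ℝ (Fin (S.n i)) :=
  Matrix.toEuclideanLin (S.g i y t) u

/-- Decentralized feedback laws: `u_i` depends on the state of the group of agent `i` and on
time. -/
abbrev Control (grp : Fin M → Fin K) : Type :=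
  ∀ i, GroupState S.n grp (grp i) → ℝ → EuclideanSpace ℝ (Fin (S.m i))

/-- The closed-loop vector field. -/
def closedLoop (grp : Fin M → Fin K) (u : S.Control grp) (x : FullState S.n) (t : ℝ) :
    FullState S.n :=
  WithLp.toLp 2 fun i =>
    S.f i (x i) t + S.input i (x i) t (u i (groupState grp (grp i) x) t) + S.c i x t

/-- `n̂ = √(n̄_k max(n_1, ..., n_M))`, where `n̄_k` is the dimension of `x̄_k`. -/
def nHat (grp : Fin M → Fin K) (k : Fin K) : ℝ :=
  Real.sqrt (((∑ i : {i : Fin M // grp i = k}, S.n i : ℕ) : ℝ) *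
    ((Finset.univ.sup S.n : ℕ) : ℝ))

/-- The partial derivative `∂B(x̄,t)/∂x_i` (as a vector) for an agent `i` of the group `k`. -/
def partialGrad {n : Fin M → ℕ} {grp : Fin M → Fin K} {k : Fin K}
    (B : GroupState n grp k → ℝ → ℝ) (x : GroupState n grp k) (t : ℝ)
    (i : {i : Fin M // grp i = k}) : EuclideanSpace ℝ (Fin (n i)) :=
  gradient (fun y => B y t) x i

/-- The load sharing function `𝔑_i`. -/
def loadShare {n : Fin M → ℕ} {grp : Fin M → Fin K} {k : Fin K}
    (B : GroupState n grp k → ℝ → ℝ) (x : GroupState n grp k) (t : ℝ)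
    (i : {i : Fin M // grp i = k}) : ℝ :=
  if ∑ d, ‖partialGrad B x t d‖ ≠ 0 then
    ‖partialGrad B x t i‖ / ∑ d, ‖partialGrad B x t d‖
  else 1

/-- The inputs admitted by the constraint of the quadratic program of agent `i` at `(x̄,t)`, for the
barrier function `B` of its group and the class `𝒦` function `α`. -/
def qpFeasible (grp : Fin M → Fin K) (i : Fin M)
    (B : GroupState S.n grp (grp i) → ℝ → ℝ) (α : ℝ → ℝ)
    (x : GroupState S.n grp (grp i)) (t : ℝ) : Set (EuclideanSpace ℝ (Fin (S.m i))) :=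
  {w | ‖partialGrad B x t ⟨i, rfl⟩‖ * S.nHat grp (grp i) * S.C
        - loadShare B x t ⟨i, rfl⟩ * (deriv (fun τ => B x τ) t + α (B x t))
      ≤ inner ℝ (partialGrad B x t ⟨i, rfl⟩)
          (S.f i (x ⟨i, rfl⟩) t + S.input i (x ⟨i, rfl⟩) t w)}

/-- `w` solves the quadratic program: it has minimal norm among the admitted inputs. -/
def IsQPSolution (grp : Fin M → Fin K) (i : Fin M)
    (B : GroupState S.n grp (grp i) → ℝ → ℝ) (α : ℝ → ℝ)
    (x : GroupState S.n grp (grp i)) (t : ℝ) (w : EuclideanSpace ℝ (Fin (S.m i))) : Prop :=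
  w ∈ S.qpFeasible grp i B α x t ∧
    ∀ w' ∈ S.qpFeasible grp i B α x t, inner ℝ w w ≤ inner ℝ w' w'

end MultiAgentSystem

end

/-!
For the group `k`, the barrier function `𝔟` stays nonnegative along the solution on
`[0, s_q]`, and this forces the robustness bound.

*Invariance.* Freezing the switches at their values on `[s_j, s_{j+1})` gives a function
(`BarrierParams.weightedBarrier`) that is locally Lipschitz everywhere and continuously
differentiable wherever `ε ≠ 0` or `x̄ ≠ 0`. Along the absolutely continuous solution it is therefore
absolutely continuous, and it suffices to have `d𝔟/dt ≥ -κ 𝔟` for almost every `t` at which the state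
lies in the open set `𝔇` (`AbsolutelyContinuousOnInterval.nonneg_of_ae_deriv_ge`). At a switch a
term is removed from the sum, so that `𝔟` can only increase.

*The barrier inequality.* If the gradient of `𝔟` in `x̄` does not vanish at the current state, the
quadratic program constraints of the agents, valid at all nearby states, add up to a linear
inequality for the closed-loop vector field with continuous coefficients, and such an inequality is
inherited by the Filippov velocities (`le_apply_of_mem_filippovMap`). If the gradient vanishes, then
`exp(-η 𝔟)` being convex the state maximizes `𝔟(·,t)`; there `𝔟 ≥ δ`, because `𝔟(ξ_{j+1},·)` is
nonincreasing with left limit at least `δ` at `s_{j+1}`, and the gain `κ` dominates the time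
derivative of `𝔟` (`BarrierParams.IsFeasible.neg_mul_le_deriv_of_isMax`).

*Robustness.* `𝔟 ≥ 0` gives `h_l ≥ γ_l` before `b_l`, hence up to `b_l` by continuity, and
`γ_l ≥ r` from `t*_l` on. Every eventually-operator is thus satisfied at its end point `b_l`, which
is what the encoding of `φ` by single operators needs (`TemporalFormula.le_robustness`).
-/

/-! ### Absolutely continuous functions -/

theorem LipschitzOnWith.comp_absolutelyContinuousOnInterval {X Y : Type*} [PseudoMetricSpace X]
    [PseudoMetricSpace Y] {f : X → Y} {g : ℝ → X} {s : Set X} {C : NNReal} {a b : ℝ}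
    (hf : LipschitzOnWith C f s) (hg : AbsolutelyContinuousOnInterval g a b)
    (hgs : MapsTo g (uIcc a b) s) : AbsolutelyContinuousOnInterval (fun t => f (g t)) a b := by
  rw [absolutelyContinuousOnInterval_iff] at hg ⊢
  intro ε hε
  obtain ⟨δ, hδ, h⟩ := hg (ε / (C + 1)) (by positivity)
  refine ⟨δ, hδ, fun I hI hlen => ?_⟩
  have hsum := h I hI hlen
  calc ∑ i ∈ Finset.range I.1, dist (f (g (I.2 i).1)) (f (g (I.2 i).2))
      ≤ ∑ i ∈ Finset.range I.1, C * dist (g (I.2 i).1) (g (I.2 i).2) :=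
        Finset.sum_le_sum fun i hi => hf.dist_le_mul _ (hgs (hI.1 i hi).1) _ (hgs (hI.1 i hi).2)
    _ = C * ∑ i ∈ Finset.range I.1, dist (g (I.2 i).1) (g (I.2 i).2) :=
        (Finset.mul_sum _ _ _).symm
    _ ≤ C * (ε / (C + 1)) := by gcongr
    _ < (C + 1) * (ε / (C + 1)) := by gcongr; linarith
    _ = ε := by field

theorem AbsolutelyContinuousOnInterval.prodMk {X Y : Type*} [PseudoMetricSpace X]
    [PseudoMetricSpace Y] {f : ℝ → X} {g : ℝ → Y} {a b : ℝ}
    (hf : AbsolutelyContinuousOnInterval f a b) (hg : AbsolutelyContinuousOnInterval g a b) :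
    AbsolutelyContinuousOnInterval (fun t => (f t, g t)) a b := by
  have hadd := Tendsto.add hf hg
  rw [add_zero] at hadd
  refine squeeze_zero (fun I => ?_) (fun I => ?_) hadd
  · exact Finset.sum_nonneg fun i _ => dist_nonneg
  · rw [← Finset.sum_add_distrib]
    refine Finset.sum_le_sum fun i _ => ?_
    rw [Prod.dist_eq]
    exact max_le_add_of_nonneg dist_nonneg dist_nonneg

theorem LocallyLipschitz.comp_absolutelyContinuousOnInterval {X Y : Type*}
    [SeminormedAddCommGroup X] [PseudoMetricSpace Y] {f : X → Y} {g : ℝ → X} {a b : ℝ}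
    (hf : LocallyLipschitz f) (hg : AbsolutelyContinuousOnInterval g a b) :
    AbsolutelyContinuousOnInterval (fun t => f (g t)) a b := by
  have hcpt : IsCompact (g '' uIcc a b) := isCompact_uIcc.image_of_continuousOn hg.continuousOn
  have hlip : LocallyLipschitzOn (g '' uIcc a b) f := hf.locallyLipschitzOn
  obtain ⟨C, hC⟩ := hlip.exists_lipschitzOnWith_of_compact hcpt
  exact hC.comp_absolutelyContinuousOnInterval hg (mapsTo_image _ _)

theorem AbsolutelyContinuousOnInterval.le_of_ae_deriv_nonneg {f : ℝ → ℝ} {a b : ℝ} (hab : a ≤ b)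
    (hf : AbsolutelyContinuousOnInterval f a b) (h : ∀ᵐ t, t ∈ Ioo a b → 0 ≤ deriv f t) :
    f a ≤ f b := by
  rw [← sub_nonneg, ← hf.integral_deriv_eq_sub, intervalIntegral.integral_of_le hab,
    integral_Ioc_eq_integral_Ioo]
  exact setIntegral_nonneg_of_ae_restrict ((ae_restrict_iff' measurableSet_Ioo).2 h)

/-- Invariance of the superlevel set `{0 ≤ b}`. The differential inequality is only available while
`y` stays in `D`; after the last time with `0 ≤ b`, the state `y` is still in `D` for a while, and
there the inequality says that `b` does not decrease. -/
theorem AbsolutelyContinuousOnInterval.nonneg_of_ae_deriv_ge {Y : Type*} [TopologicalSpace Y]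
    {b : ℝ → ℝ} {y : ℝ → Y} {α β κ : ℝ} {D : Set Y} (hb : AbsolutelyContinuousOnInterval b α β)
    (hy : ContinuousOn y (Icc α β)) (hD : IsOpen D) (hκ : 0 ≤ κ)
    (hbD : ∀ t ∈ Ico α β, 0 ≤ b t → y t ∈ D)
    (hderiv : ∀ᵐ t, t ∈ Ioo α β → y t ∈ D → -(κ * b t) ≤ deriv b t)
    (h0 : 0 ≤ b α) {t : ℝ} (ht : t ∈ Icc α β) : 0 ≤ b t := by
  have hαβ : α ≤ β := ht.1.trans ht.2
  have hbc : ContinuousOn b (Icc α β) := by simpa [uIcc_of_le hαβ] using hb.continuousOn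
  by_contra! hneg
  have hclosed : IsClosed {s | s ∈ Icc α t ∧ b s ∈ Ici 0} := by
    exact (hbc.mono (Icc_subset_Icc_right ht.2)).preimage_isClosed_of_isClosed
      isClosed_Icc isClosed_Ici
  have hcpt : IsCompact {s | s ∈ Icc α t ∧ b s ∈ Ici 0} :=
    isCompact_Icc.of_isClosed_subset hclosed fun s hs => hs.1
  obtain ⟨σ, ⟨hσ, hbσ⟩, hmax⟩ := hcpt.exists_isGreatest ⟨α, And.intro ⟨le_rfl, ht.1⟩ h0⟩
  have hbσ' : 0 ≤ b σ := hbσ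
  have hσt : σ < t := lt_of_le_of_ne hσ.2 fun h => by rw [h] at hbσ'; linarith
  have hafter : ∀ s ∈ Ioc σ t, b s < 0 := fun s hs => by
    by_contra! hs'
    exact absurd (hmax ⟨⟨hσ.1.trans hs.1.le, hs.2⟩, hs'⟩) (not_le.2 hs.1)
  have hσβ : σ ∈ Ico α β := ⟨hσ.1, hσt.trans_le ht.2⟩
  have hnhds : y ⁻¹' D ∈ 𝓝[Icc α β] σ :=
    (hy σ ⟨hσ.1, hσβ.2.le⟩) (hD.mem_nhds (hbD σ hσβ hbσ'))
  have hnhds' : y ⁻¹' D ∈ 𝓝[>] σ := by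
    rw [← nhdsWithin_Ioo_eq_nhdsGT hσβ.2]
    exact nhdsWithin_mono _ (Ioo_subset_Icc_self.trans (Icc_subset_Icc_left hσ.1)) hnhds
  obtain ⟨τ, hτ, hτD⟩ := (mem_nhdsGT_iff_exists_Ioo_subset' hσt).1 hnhds'
  have hlt : σ < min τ t := lt_min hτ hσt
  have hsub : uIcc σ (min τ t) ⊆ uIcc α β := by
    rw [uIcc_of_le hlt.le, uIcc_of_le hαβ]
    exact Icc_subset_Icc hσ.1 ((min_le_right _ _).trans ht.2)
  have hle := (hb.mono hsub).le_of_ae_deriv_nonneg hlt.le (by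
    filter_upwards [hderiv] with s hs hsI
    have hst : s < t := hsI.2.trans_le (min_le_right _ _)
    have h1 := hs ⟨hσ.1.trans_lt hsI.1, hst.trans_le ht.2⟩
      (hτD ⟨hsI.1, hsI.2.trans_le (min_le_left _ _)⟩)
    have h2 := hafter s ⟨hsI.1, hst.le⟩
    nlinarith)
  have := hafter _ ⟨hlt, min_le_right _ _⟩
  linarith

/-! ### Robustness from the encoding by single operators -/

theorem StateFormula.le_robustness {E : Type} {x : ℝ → E} {r t : ℝ} {ψ : StateFormula E}
    (h : ∀ g ∈ ψ.predicates, r ≤ g (x t)) : (r : EReal) ≤ ψ.robustness x t := by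
  induction ψ with
  | top => exact le_top
  | pred g => exact EReal.coe_le_coe_iff.2 (h g (by simp [predicates]))
  | npred g => exact EReal.coe_le_coe_iff.2 (h (fun y => -g y) (by simp [predicates]))
  | conj ψ₁ ψ₂ ih₁ ih₂ =>
    exact le_min (ih₁ fun g hg => h g (by simp [predicates, hg]))
      (ih₂ fun g hg => h g (by simp [predicates, hg]))

theorem TemporalFormula.nonneg_and_le_of_mem_tasks {E : Type} {φ : TemporalFormula E}
    {τ : STLTask E} (hτ : τ ∈ φ.tasks) : 0 ≤ τ.a ∧ τ.a ≤ τ.b := by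
  induction φ with
  | always a b ha hab ψ =>
    obtain ⟨h, -, rfl⟩ := List.mem_map.1 hτ
    exact ⟨ha, hab⟩
  | eventually a b ha hab ψ =>
    obtain ⟨h, -, rfl⟩ := List.mem_map.1 hτ
    exact ⟨ha, hab⟩
  | untl c a b hc hca hab ψ₁ ψ₂ =>
    rcases List.mem_append.1 hτ with hτ | hτ <;> obtain ⟨h, -, rfl⟩ := List.mem_map.1 hτ
    · exact ⟨hc, hca.trans hab⟩
    · exact ⟨(hc.trans hca).trans hab, le_rfl⟩
  | conj φ₁ φ₂ ih₁ ih₂ => exact (List.mem_append.1 hτ).elim ih₁ ih₂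

/-- If the predicate function of every always-operator is at least `r` on all of `[a,b]`, and that
of every eventually-operator at the end point `b`, then the robustness at time `0` is at least `r`.
Witnessing all eventually-operators at `b` makes the encoding sound for conjunctions below an
eventually- or until-operator. -/
theorem TemporalFormula.le_robustness {E : Type} {x : ℝ → E} {r : ℝ} {φ : TemporalFormula E}
    (h : ∀ τ ∈ φ.tasks, ∀ t ∈ Icc τ.tStar τ.b, r ≤ τ.h (x t)) :
    (r : EReal) ≤ φ.robustness x 0 := by
  induction φ with
  | always a b ha hab ψ =>
    refine le_iInf₂ fun t ht => StateFormula.le_robustness fun g hg => ?_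
    rw [zero_add, zero_add] at ht
    exact h ⟨true, a, b, g⟩ (List.mem_map.2 ⟨g, hg, rfl⟩) t ht
  | eventually a b ha hab ψ =>
    refine le_iSup₂_of_le b (by simpa using hab) (StateFormula.le_robustness fun g hg => ?_)
    exact h ⟨false, a, b, g⟩ (List.mem_map.2 ⟨g, hg, rfl⟩) b ⟨le_rfl, le_rfl⟩
  | untl c a b hc hca hab ψ₁ ψ₂ =>
    refine le_iSup₂_of_le b (by simpa using hab) (le_min
      (StateFormula.le_robustness fun g hg => ?_)
      (le_iInf₂ fun t ht => StateFormula.le_robustness fun g hg => ?_))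
    · exact h ⟨false, b, b, g⟩ (List.mem_append_right _ (List.mem_map.2 ⟨g, hg, rfl⟩)) b
        ⟨le_rfl, le_rfl⟩
    · rw [zero_add] at ht
      exact h ⟨true, c, b, g⟩ (List.mem_append_left _ (List.mem_map.2 ⟨g, hg, rfl⟩)) t ht
  | conj φ₁ φ₂ ih₁ ih₂ =>
    exact le_min (ih₁ fun τ hτ => h τ (List.mem_append_left _ hτ))
      (ih₂ fun τ hτ => h τ (List.mem_append_right _ hτ))

/-! ### The switching sequence -/

section Switching

variable {E : Type} {φ : TemporalFormula E}

theorem TemporalFormula.task_mem (l : Fin φ.numTasks) : φ.task l ∈ φ.tasks := List.get_mem _ _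

theorem TemporalFormula.exists_task_eq {τ : STLTask E} (hτ : τ ∈ φ.tasks) :
    ∃ l, φ.task l = τ := List.get_of_mem hτ

theorem TemporalFormula.mem_switchTimes {s : ℝ} :
    s ∈ φ.switchTimes ↔ (∃ τ ∈ φ.tasks, τ.b = s) ∧ 0 < s := by
  simp [switchTimes]

theorem TemporalFormula.switchSeq_succ (j : Fin φ.numSwitches) :
    φ.switchSeq j.succ = φ.switchTimes.orderEmbOfFin rfl j := rfl

theorem TemporalFormula.switchSeq_succ_mem (j : Fin φ.numSwitches) :
    φ.switchSeq j.succ ∈ φ.switchTimes := by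
  rw [switchSeq_succ]
  exact Finset.orderEmbOfFin_mem _ _ _

theorem TemporalFormula.switchSeq_strictMono : StrictMono φ.switchSeq := by
  intro i j hij
  obtain ⟨j, rfl⟩ := Fin.exists_succ_eq.2 (Fin.ne_zero_of_lt hij)
  rcases Fin.eq_zero_or_eq_succ i with rfl | ⟨i, rfl⟩
  · exact (mem_switchTimes.1 (switchSeq_succ_mem j)).2
  · rw [switchSeq_succ, switchSeq_succ]
    exact (φ.switchTimes.orderEmbOfFin rfl).strictMono (Fin.succ_lt_succ_iff.1 hij)

theorem TemporalFormula.switchSeq_nonneg (j : Fin (φ.numSwitches + 1)) : 0 ≤ φ.switchSeq j :=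
  switchSeq_strictMono.monotone (Fin.zero_le j)

theorem TemporalFormula.exists_switchSeq_eq {τ : STLTask E} (hτ : τ ∈ φ.tasks) (hb : 0 < τ.b) :
    ∃ j : Fin φ.numSwitches, φ.switchSeq j.succ = τ.b := by
  have hmem : τ.b ∈ Set.range (φ.switchTimes.orderEmbOfFin rfl) := by
    rw [Finset.range_orderEmbOfFin]
    exact mem_switchTimes.2 ⟨⟨τ, hτ, rfl⟩, hb⟩
  obtain ⟨j, hj⟩ := hmem
  exact ⟨j, hj⟩

/-- Between two consecutive switching times no operator is switched off. -/
theorem TemporalFormula.switch_eq_of_mem_Ico [NormedAddCommGroup E] {j : Fin φ.numSwitches} {t : ℝ}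
    (ht : t ∈ Ico (φ.switchSeq j.castSucc) (φ.switchSeq j.succ)) (l : Fin φ.numTasks) :
    φ.switch l t = φ.switch l (φ.switchSeq j.castSucc) := by
  have : t < (φ.task l).b ↔ φ.switchSeq j.castSucc < (φ.task l).b := by
    refine ⟨ht.1.trans_lt, fun h => ?_⟩
    obtain ⟨i, hi⟩ := exists_switchSeq_eq (task_mem l) ((switchSeq_nonneg _).trans_lt h)
    rw [← hi] at h ⊢
    have hji : j.castSucc < i.succ := switchSeq_strictMono.lt_iff_lt.1 h
    exact ht.2.trans_le (switchSeq_strictMono.monotone (by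
      rw [Fin.lt_def] at hji
      rw [Fin.le_def]
      simpa using Nat.succ_le_of_lt hji))
  simp only [switch, this]

theorem TemporalFormula.switch_nonneg [NormedAddCommGroup E] (l : Fin φ.numTasks) (t : ℝ) :
    0 ≤ φ.switch l t := by
  unfold switch; split_ifs <;> norm_num

theorem TemporalFormula.switch_antitone [NormedAddCommGroup E] (l : Fin φ.numTasks) :
    Antitone (φ.switch l) := by
  intro s t hst
  unfold switch
  split_ifs <;> linarith

end Switching

/-! ### The barrier function with frozen switches -/

section Gamma

variable {E : Type} {φ : TemporalFormula E} {P : BarrierParams φ}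

theorem BarrierParams.contDiff_gamma (l : Fin φ.numTasks) : ContDiff ℝ 1 (P.gamma l) :=
  (contDiff_const.mul (contDiff_const.mul contDiff_id).exp).add contDiff_const

theorem BarrierParams.hasDerivAt_gamma (l : Fin φ.numTasks) (t : ℝ) :
    HasDerivAt (P.gamma l) (P.Delta l * Real.exp (-P.rate l * t)) t := by
  have h := (((hasDerivAt_id t).const_mul (-P.rate l)).exp.const_mul
    (P.γ₀ l - P.γinf l)).add_const (P.γinf l)
  convert! h using 1
  simp only [Delta, id]
  ring

end Gamma

section WeightedBarrier

variable {E : Type} [NormedAddCommGroup E] {φ : TemporalFormula E}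

/-- The sum `∑_l w_l exp(-η 𝔟_l(x,t)) + exp(-η 𝔟_{p+1}(x))`, with constant weights `w` in place of
the switches `𝔬_l(t)`. -/
noncomputable def BarrierParams.expSum (P : BarrierParams φ) (ε : ℝ) (w : Fin φ.numTasks → ℝ)
    (x : E) (t : ℝ) : ℝ :=
  ∑ l, w l * Real.exp (-P.η * P.taskBarrier l x t) + Real.exp (-P.η * P.boundBarrier ε x)

/-- The barrier function with constant weights `w` in place of the switches `𝔬_l(t)`. Between two
switching times it agrees with the barrier function, but it is regular beyond them. -/
noncomputable def BarrierParams.weightedBarrier (P : BarrierParams φ) (ε : ℝ)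
    (w : Fin φ.numTasks → ℝ) (x : E) (t : ℝ) : ℝ :=
  -(1 / P.η) * Real.log (P.expSum ε w x t)

theorem BarrierParams.barrier_eq_weightedBarrier (P : BarrierParams φ) (ε : ℝ) (x : E) (t : ℝ) :
    P.barrier ε x t = P.weightedBarrier ε (fun l => φ.switch l t) x t := rfl

theorem BarrierParams.barrier_eq_of_mem_Ico {P : BarrierParams φ} {ε : ℝ} {j : Fin φ.numSwitches}
    {t : ℝ} (ht : t ∈ Ico (φ.switchSeq j.castSucc) (φ.switchSeq j.succ)) (x : E) :
    P.barrier ε x t =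
      P.weightedBarrier ε (fun l => φ.switch l (φ.switchSeq j.castSucc)) x t := by
  rw [barrier_eq_weightedBarrier]
  congr 1
  ext l
  exact TemporalFormula.switch_eq_of_mem_Ico ht l

variable {P : BarrierParams φ} {ε : ℝ} {w : Fin φ.numTasks → ℝ} {x : E} {t : ℝ}

theorem BarrierParams.expSum_pos (hw : ∀ l, 0 ≤ w l) : 0 < P.expSum ε w x t :=
  add_pos_of_nonneg_of_pos
    (Finset.sum_nonneg fun l _ => mul_nonneg (hw l) (Real.exp_pos _).le) (Real.exp_pos _)

theorem BarrierParams.expSum_eq_exp (hw : ∀ l, 0 ≤ w l) (hη : 0 < P.η) :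
    P.expSum ε w x t = Real.exp (-P.η * P.weightedBarrier ε w x t) := by
  have h : -P.η * P.weightedBarrier ε w x t = Real.log (P.expSum ε w x t) := by
    rw [weightedBarrier]
    field_simp
  rw [h, Real.exp_log (expSum_pos hw)]

theorem BarrierParams.weightedBarrier_le_iff {w' : Fin φ.numTasks → ℝ} {y : E} {s : ℝ}
    (hw : ∀ l, 0 ≤ w l) (hw' : ∀ l, 0 ≤ w' l) (hη : 0 < P.η) :
    P.weightedBarrier ε w x t ≤ P.weightedBarrier ε w' y s ↔
      P.expSum ε w' y s ≤ P.expSum ε w x t := by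
  rw [expSum_eq_exp hw hη, expSum_eq_exp hw' hη, Real.exp_le_exp]
  constructor <;> intro h <;> nlinarith

theorem BarrierParams.weightedBarrier_anti {w' : Fin φ.numTasks → ℝ} (hw' : ∀ l, 0 ≤ w' l)
    (hww' : ∀ l, w' l ≤ w l) (hη : 0 < P.η) :
    P.weightedBarrier ε w x t ≤ P.weightedBarrier ε w' x t := by
  rw [weightedBarrier_le_iff (fun l => (hw' l).trans (hww' l)) hw' hη]
  unfold expSum
  gcongr with l
  exact hww' l

theorem BarrierParams.weightedBarrier_le_boundBarrier (hw : ∀ l, 0 ≤ w l) (hη : 0 < P.η) :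
    P.weightedBarrier ε w x t ≤ P.boundBarrier ε x := by
  have h : Real.exp (-P.η * P.boundBarrier ε x) ≤ P.expSum ε w x t :=
    le_add_of_nonneg_left (Finset.sum_nonneg fun l _ => mul_nonneg (hw l) (Real.exp_pos _).le)
  rw [expSum_eq_exp hw hη, Real.exp_le_exp] at h
  nlinarith

theorem BarrierParams.weightedBarrier_le_taskBarrier (hw : ∀ l, 0 ≤ w l) (hη : 0 < P.η)
    {l : Fin φ.numTasks} (hl : w l = 1) :
    P.weightedBarrier ε w x t ≤ P.taskBarrier l x t := by
  have h : Real.exp (-P.η * P.taskBarrier l x t) ≤ P.expSum ε w x t := by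
    have h1 := Finset.single_le_sum
      (f := fun l => w l * Real.exp (-P.η * P.taskBarrier l x t))
      (fun l _ => mul_nonneg (hw l) (Real.exp_pos _).le) (Finset.mem_univ l)
    simp only [hl, one_mul] at h1
    exact h1.trans (le_add_of_nonneg_right (Real.exp_pos _).le)
  rw [expSum_eq_exp hw hη, Real.exp_le_exp] at h
  nlinarith

/-! ### Time dependence of the barrier function -/

theorem BarrierParams.hasDerivAt_weightedBarrier (hw : ∀ l, 0 ≤ w l) (hη : 0 < P.η) (x : E)
    (t : ℝ) :
    HasDerivAt (fun τ => P.weightedBarrier ε w x τ)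
      (-(∑ l, w l * Real.exp (-P.η * P.taskBarrier l x t)
        * (P.Delta l * Real.exp (-P.rate l * t))) / P.expSum ε w x t) t := by
  have h1 : ∀ l, HasDerivAt (fun τ => w l * Real.exp (-P.η * P.taskBarrier l x τ))
      (P.η * (w l * Real.exp (-P.η * P.taskBarrier l x t)
        * (P.Delta l * Real.exp (-P.rate l * t)))) t := by
    intro l
    have h := ((((hasDerivAt_gamma (P := P) l t).neg.add_const
      ((φ.task l).h x)).const_mul (-P.η)).exp.const_mul (w l))
    convert! h using 1
    simp only [taskBarrier, Pi.neg_apply]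
    ring
  have h2 : HasDerivAt (fun τ => P.expSum ε w x τ) _ t :=
    (HasDerivAt.fun_sum fun l _ => h1 l).add_const (Real.exp (-P.η * P.boundBarrier ε x))
  convert! (h2.log (expSum_pos hw).ne').const_mul (-(1 / P.η)) using 1
  rw [← Finset.mul_sum, neg_div, neg_mul, neg_inj]
  generalize ∑ l, w l * Real.exp (-P.η * P.taskBarrier l x t)
    * (P.Delta l * Real.exp (-P.rate l * t)) = A
  field_simp

variable {δ : ℝ} {x₀ : E}

theorem BarrierParams.IsFeasible.rate_nonneg (hP : P.IsFeasible ε δ x₀) (l : Fin φ.numTasks) :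
    0 ≤ P.rate l := by
  rw [hP.rate_eq l]
  split_ifs with h
  · have h1 := hP.gamma_inf l
    have h2 : P.r < P.γinf l := (le_max_left _ _).trans_lt h1.1
    have h3 : 0 < (φ.task l).tStar := by
      by_contra h4
      exact absurd ((hP.gamma_zero l).2 h4) (not_le.2 h)
    have h4 : (P.r - P.γinf l) / (P.γ₀ l - P.γinf l) ≤ 1 :=
      (div_le_one_of_neg (by linarith)).2 (by linarith)
    have h5 : 0 ≤ (P.r - P.γinf l) / (P.γ₀ l - P.γinf l) :=
      div_nonneg_of_nonpos (by linarith) (by linarith)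
    exact div_nonneg (neg_nonneg.2 (Real.log_nonpos h5 h4)) h3.le
  · exact le_rfl

theorem BarrierParams.IsFeasible.delta_nonneg (hP : P.IsFeasible ε δ x₀) (l : Fin φ.numTasks) :
    0 ≤ P.Delta l :=
  mul_nonneg (hP.rate_nonneg l)
    (sub_nonneg.2 ((le_max_right _ _).trans_lt (hP.gamma_inf l).1).le)

theorem BarrierParams.IsFeasible.gamma_monotone (hP : P.IsFeasible ε δ x₀)
    (l : Fin φ.numTasks) : Monotone (P.gamma l) :=
  monotone_of_hasDerivAt_nonneg (hasDerivAt_gamma l)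
    fun _ => mul_nonneg (hP.delta_nonneg l) (Real.exp_pos _).le

/-- From `t*` on, the threshold `γ_l` is at least `r`; this is what the choice of the rate
achieves. -/
theorem BarrierParams.IsFeasible.r_le_gamma (hP : P.IsFeasible ε δ x₀) (l : Fin φ.numTasks)
    {t : ℝ} (ht : (φ.task l).tStar ≤ t) : P.r ≤ P.gamma l t := by
  refine le_trans ?_ (hP.gamma_monotone l ht)
  by_cases h : P.γ₀ l < P.r
  · have h2 : P.r < P.γinf l := (le_max_left _ _).trans_lt (hP.gamma_inf l).1
    have h3 : 0 < (φ.task l).tStar := by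
      by_contra h4
      exact absurd ((hP.gamma_zero l).2 h4) (not_le.2 h)
    have h5 : 0 < (P.r - P.γinf l) / (P.γ₀ l - P.γinf l) :=
      div_pos_of_neg_of_neg (by linarith) (by linarith)
    have h6 : P.γ₀ l - P.γinf l ≠ 0 := by linarith
    have h7 : -P.rate l * (φ.task l).tStar
        = Real.log ((P.r - P.γinf l) / (P.γ₀ l - P.γinf l)) := by
      rw [hP.rate_eq l, if_pos h]
      field_simp
    rw [gamma, h7, Real.exp_log h5]
    field_simp
    linarith
  · have h1 : P.rate l = 0 := by rw [hP.rate_eq l, if_neg h]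
    rw [gamma, h1]
    simpa using h

theorem BarrierParams.IsFeasible.weightedBarrier_antitone (hP : P.IsFeasible ε δ x₀)
    (hw : ∀ l, 0 ≤ w l) (x : E) : Antitone fun t => P.weightedBarrier ε w x t := by
  intro s t hst
  rw [weightedBarrier_le_iff hw hw hP.eta_pos]
  refine add_le_add_left (Finset.sum_le_sum fun l _ =>
    mul_le_mul_of_nonneg_left (Real.exp_le_exp.2 ?_) (hw l)) _
  have hγ := hP.gamma_monotone l hst
  have hη := hP.eta_pos
  unfold taskBarrier
  nlinarith

end WeightedBarrier

/-! ### Smoothness and critical points of the barrier function -/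

section Regularity

theorem sqrt_sq_add_norm_sq (ε : ℝ) {E : Type} [NormedAddCommGroup E] (x : E) :
    Real.sqrt (ε ^ 2 + ‖x‖ ^ 2) = ‖WithLp.toLp 2 (ε, x)‖ := by
  simp [WithLp.prod_norm_eq_of_L2]

variable {E : Type} [NormedAddCommGroup E] [InnerProductSpace ℝ E]

omit [InnerProductSpace ℝ E] in
theorem lipschitzWith_sqrt_sq_add_norm_sq (ε : ℝ) :
    LipschitzWith 1 fun x : E => Real.sqrt (ε ^ 2 + ‖x‖ ^ 2) := by
  refine LipschitzWith.of_dist_le_mul fun x y => ?_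
  rw [sqrt_sq_add_norm_sq, sqrt_sq_add_norm_sq, Real.dist_eq, NNReal.coe_one, one_mul]
  refine (abs_norm_sub_norm_le _ _).trans ?_
  rw [← WithLp.toLp_sub, WithLp.prod_norm_eq_of_L2, dist_eq_norm]
  simp

theorem convexOn_sqrt_sq_add_norm_sq (ε : ℝ) :
    ConvexOn ℝ univ fun x : E => Real.sqrt (ε ^ 2 + ‖x‖ ^ 2) := by
  refine ⟨convex_univ, fun x _ y _ a b ha hb hab => ?_⟩
  have h : (WithLp.toLp 2 (ε, a • x + b • y) : WithLp 2 (ℝ × E)) =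
      a • WithLp.toLp 2 (ε, x) + b • WithLp.toLp 2 (ε, y) := by
    rw [← WithLp.toLp_smul, ← WithLp.toLp_smul, ← WithLp.toLp_add]
    congr 2
    simp [← add_mul, hab]
  simp only [sqrt_sq_add_norm_sq, h, smul_eq_mul]
  refine (norm_add_le _ _).trans ?_
  rw [norm_smul, norm_smul, Real.norm_of_nonneg ha, Real.norm_of_nonneg hb]

variable {φ : TemporalFormula E} {P : BarrierParams φ} {ε : ℝ} {w : Fin φ.numTasks → ℝ}

theorem BarrierParams.contDiff_taskBarrier (hC1 : ∀ τ ∈ φ.tasks, ContDiff ℝ 1 τ.h)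
    (l : Fin φ.numTasks) : ContDiff ℝ 1 fun q : E × ℝ => P.taskBarrier l q.1 q.2 := by
  unfold taskBarrier
  exact ((contDiff_gamma l).comp contDiff_snd).neg.add
    ((hC1 _ (TemporalFormula.task_mem l)).comp contDiff_fst)

/-- With `√(ε² + ‖x‖²)` replaced by a free variable, the weighted barrier function becomes
continuously differentiable, also for `ε = 0`. -/
theorem BarrierParams.contDiff_barrier_free (hC1 : ∀ τ ∈ φ.tasks, ContDiff ℝ 1 τ.h)
    (hw : ∀ l, 0 ≤ w l) :
    ContDiff ℝ 1 fun q : ℝ × E × ℝ => -(1 / P.η) * Real.log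
      (∑ l, w l * Real.exp (-P.η * P.taskBarrier l q.2.1 q.2.2)
        + Real.exp (-P.η * (P.D - q.1))) := by
  refine contDiff_const.mul (ContDiff.log ?_ fun q => ?_)
  · refine ContDiff.add (ContDiff.sum fun l _ => contDiff_const.mul
      (contDiff_const.mul ((contDiff_taskBarrier hC1 l).comp contDiff_snd)).exp) ?_
    fun_prop
  · exact (add_pos_of_nonneg_of_pos (Finset.sum_nonneg fun l _ =>
      mul_nonneg (hw l) (Real.exp_pos _).le) (Real.exp_pos _)).ne'

theorem BarrierParams.locallyLipschitz_weightedBarrier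
    (hC1 : ∀ τ ∈ φ.tasks, ContDiff ℝ 1 τ.h) (hw : ∀ l, 0 ≤ w l) :
    LocallyLipschitz fun q : E × ℝ => P.weightedBarrier ε w q.1 q.2 := by
  have h : LocallyLipschitz fun q : E × ℝ => (Real.sqrt (ε ^ 2 + ‖q.1‖ ^ 2), q) :=
    (((lipschitzWith_sqrt_sq_add_norm_sq ε).comp LipschitzWith.prod_fst).prodMk
      LipschitzWith.id).locallyLipschitz
  have hcomp := (contDiff_barrier_free (P := P) hC1 hw).locallyLipschitz.comp h
  simp only [Function.comp_def] at hcomp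
  unfold weightedBarrier expSum boundBarrier
  exact hcomp

theorem BarrierParams.continuous_weightedBarrier {Z : Type*} [TopologicalSpace Z]
    (hC1 : ∀ τ ∈ φ.tasks, ContDiff ℝ 1 τ.h) (hw : ∀ l, 0 ≤ w l) {f : Z → E} {g : Z → ℝ}
    (hf : Continuous f) (hg : Continuous g) :
    Continuous fun z => P.weightedBarrier ε w (f z) (g z) := by
  have hcomp := (locallyLipschitz_weightedBarrier (P := P) (ε := ε) hC1 hw).continuous.comp
    (hf.prodMk hg)
  simpa only [Function.comp_def] using hcomp

theorem BarrierParams.contDiffAt_weightedBarrier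
    (hC1 : ∀ τ ∈ φ.tasks, ContDiff ℝ 1 τ.h) (hw : ∀ l, 0 ≤ w l) {x : E} (hx : ε ≠ 0 ∨ x ≠ 0)
    (t : ℝ) : ContDiffAt ℝ 1 (fun q : E × ℝ => P.weightedBarrier ε w q.1 q.2) (x, t) := by
  have h : ContDiffAt ℝ 1 (fun q : E × ℝ => (Real.sqrt (ε ^ 2 + ‖q.1‖ ^ 2), q)) (x, t) := by
    refine ContDiffAt.prodMk (ContDiffAt.sqrt ?_ ?_) contDiffAt_id
    · exact (contDiff_const.add (contDiff_fst.norm_sq ℝ)).contDiffAt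
    · rcases hx with hx | hx
      · positivity
      · have : 0 < ‖x‖ := norm_pos_iff.2 hx
        positivity
  have hcomp := (contDiff_barrier_free (P := P) hC1 hw).contDiffAt.comp (x, t) h
  simp only [Function.comp_def] at hcomp
  unfold weightedBarrier expSum boundBarrier
  exact hcomp

omit [InnerProductSpace ℝ E] in
theorem convexOn_finset_sum [NormedSpace ℝ E] {ι : Type*} (s : Finset ι) {f : ι → E → ℝ}
    (hf : ∀ i, ConvexOn ℝ univ (f i)) : ConvexOn ℝ univ fun x => ∑ i ∈ s, f i x := by
  classical
  induction s using Finset.induction_on with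
  | empty => simpa using convexOn_const (0 : ℝ) convex_univ
  | insert i s hi ih =>
    simp only [Finset.sum_insert hi]
    exact (hf i).add ih

/-- A critical point of the weighted barrier function is a global maximizer, because
`exp(-η 𝔟) = expSum` is convex. -/
theorem BarrierParams.le_of_hasFDerivAt_zero (hconc : ∀ τ ∈ φ.tasks, ConcaveOn ℝ univ τ.h)
    (hw : ∀ l, 0 ≤ w l) (hη : 0 < P.η) {x : E} {t : ℝ}
    (hx : HasFDerivAt (fun y => P.weightedBarrier ε w y t) (0 : E →L[ℝ] ℝ) x) (y : E) :
    P.weightedBarrier ε w y t ≤ P.weightedBarrier ε w x t := by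
  have hexp : ∀ f : E → ℝ, ConvexOn ℝ univ f → ConvexOn ℝ univ fun x => Real.exp (f x) := by
    refine fun f hf => ⟨convex_univ, fun a _ b _ c d hc hd hcd => ?_⟩
    exact (Real.exp_le_exp.2 (hf.2 (mem_univ a) (mem_univ b) hc hd hcd)).trans
      (convexOn_exp.2 (mem_univ _) (mem_univ _) hc hd hcd)
  have hconv : ConvexOn ℝ univ fun y => P.expSum ε w y t := by
    unfold expSum
    refine ConvexOn.add (convexOn_finset_sum _ fun l => ?_) (hexp _ ?_)
    · refine ConvexOn.smul (hw l) (hexp _ ?_)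
      have h1 : ConvexOn ℝ univ fun y => P.η * (-(φ.task l).h y + P.gamma l t) :=
        ConvexOn.smul hη.le
          ((hconc _ (TemporalFormula.task_mem l)).neg.add (convexOn_const _ convex_univ))
      convert h1 using 2 with y
      rw [taskBarrier]
      ring
    · have h1 : ConvexOn ℝ univ fun y : E => P.η * (Real.sqrt (ε ^ 2 + ‖y‖ ^ 2) + -P.D) :=
        ConvexOn.smul hη.le ((convexOn_sqrt_sq_add_norm_sq ε).add (convexOn_const _ convex_univ))
      convert h1 using 2 with y
      rw [boundBarrier]
      ring
  -- Restriction to the line through `x` and `y` reduces the claim to one variable.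
  have hline : ConvexOn ℝ univ fun s : ℝ => P.expSum ε w (AffineMap.lineMap x y s) t := by
    simpa using! hconv.comp_affineMap (AffineMap.lineMap x y)
  have hderiv : HasDerivAt (fun s : ℝ => P.expSum ε w (AffineMap.lineMap x y s) t) 0 0 := by
    have h1 : HasDerivAt (fun s : ℝ => (AffineMap.lineMap x y s : E)) (y - x) 0 :=
      AffineMap.hasDerivAt_lineMap
    have h2 : HasFDerivAt (fun y => P.weightedBarrier ε w y t) (0 : E →L[ℝ] ℝ)
        (AffineMap.lineMap x y (0 : ℝ)) := by simpa using hx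
    have h3 := ((h2.comp_hasDerivAt (0 : ℝ) h1).const_mul (-P.η)).exp
    simp only [expSum_eq_exp hw hη]
    simpa using! h3
  have hmin : IsMinOn (fun s : ℝ => P.expSum ε w (AffineMap.lineMap x y s) t) univ 0 :=
    hline.isMinOn_of_rightDeriv_eq_zero (by simp)
      (hderiv.hasDerivWithinAt.derivWithin (uniqueDiffWithinAt_Ioi 0))
  rw [weightedBarrier_le_iff hw hw hη]
  simpa using hmin (mem_univ (1 : ℝ))

/-! ### The barrier inequality at maximizers -/

variable {δ : ℝ} {x₀ : E}

/-- Before the switching time `s_{j+1}`, the barrier function attains a value of at least `δ`. -/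
theorem BarrierParams.IsFeasible.exists_le_weightedBarrier (hP : P.IsFeasible ε δ x₀)
    (hC1 : ∀ τ ∈ φ.tasks, ContDiff ℝ 1 τ.h) (j : Fin φ.numSwitches) {t : ℝ}
    (ht : t ≤ φ.switchSeq j.succ) :
    ∃ y, δ ≤ P.weightedBarrier ε (fun l => φ.switch l (φ.switchSeq j.castSucc)) y t := by
  have hw := fun l => TemporalFormula.switch_nonneg (φ := φ) l (φ.switchSeq j.castSucc)
  obtain ⟨L, hL, hδL⟩ := hP.switching j
  refine ⟨P.ξ j, le_trans ?_ (hP.weightedBarrier_antitone hw (P.ξ j) ht)⟩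
  have hcont : Continuous fun t => P.weightedBarrier ε
      (fun l => φ.switch l (φ.switchSeq j.castSucc)) (P.ξ j) t :=
    continuous_weightedBarrier hC1 hw (by fun_prop) (by fun_prop)
  have hlim := (hcont.tendsto (φ.switchSeq j.succ)).mono_left
    (nhdsWithin_le_nhds (s := Iio (φ.switchSeq j.succ)))
  have hev : (fun t => P.barrier ε (P.ξ j) t) =ᶠ[𝓝[<] (φ.switchSeq j.succ)] fun t =>
      P.weightedBarrier ε (fun l => φ.switch l (φ.switchSeq j.castSucc)) (P.ξ j) t := by
    have hlt := TemporalFormula.switchSeq_strictMono (φ := φ) j.castSucc_lt_succ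
    filter_upwards [Ico_mem_nhdsLT hlt] with t ht
    exact barrier_eq_of_mem_Ico ht _
  exact hδL.trans_eq (tendsto_nhds_unique hL (hlim.congr' hev.symm))

/-- At a maximizer of `𝔟(·,t)`, where the inputs have no influence on the barrier function, the gain
`κ` is large enough for the barrier inequality to hold: all active functions lie in `[δ, 𝔟max]`,
hence `Δ_l ≤ -ζ_l ≤ κ δ`. -/
theorem BarrierParams.IsFeasible.neg_mul_le_deriv_of_isMax (hP : P.IsFeasible ε δ x₀)
    (hC1 : ∀ τ ∈ φ.tasks, ContDiff ℝ 1 τ.h) (hδ : 0 < δ) {bmax κ : ℝ}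
    (hbmax : P.IsMaxBound ε bmax) (hκpos : 0 < κ)
    (hκ : ∀ l, -P.zeta δ bmax l / δ < κ) (j : Fin φ.numSwitches) {t : ℝ}
    (ht : t ∈ Ico (φ.switchSeq j.castSucc) (φ.switchSeq j.succ)) {x : E}
    (hx : ∀ y, P.weightedBarrier ε (fun l => φ.switch l (φ.switchSeq j.castSucc)) y t ≤
      P.weightedBarrier ε (fun l => φ.switch l (φ.switchSeq j.castSucc)) x t) :
    -(κ * P.weightedBarrier ε (fun l => φ.switch l (φ.switchSeq j.castSucc)) x t) ≤
      deriv (fun τ => P.weightedBarrier ε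
        (fun l => φ.switch l (φ.switchSeq j.castSucc)) x τ) t := by
  set w : Fin φ.numTasks → ℝ := fun l => φ.switch l (φ.switchSeq j.castSucc) with hwdef
  have hw : ∀ l, 0 ≤ w l := fun l => TemporalFormula.switch_nonneg l _
  have hη := hP.eta_pos
  have ht0 : 0 ≤ t := (TemporalFormula.switchSeq_nonneg _).trans ht.1
  have hbar : ∀ y, P.barrier ε y t = P.weightedBarrier ε w y t := barrier_eq_of_mem_Ico ht
  obtain ⟨y, hy⟩ := hP.exists_le_weightedBarrier hC1 j ht.2.le
  have hδx : δ ≤ P.weightedBarrier ε w x t := hy.trans (hx y)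
  have hlast : t < φ.switchSeq (Fin.last _) :=
    ht.2.trans_le (TemporalFormula.switchSeq_strictMono.monotone (Fin.le_last _))
  have hδb : δ ≤ bmax := (hδx.trans (weightedBarrier_le_boundBarrier hw hη)).trans
    (hbmax t ⟨ht0, hlast⟩ x fun y => by rw [hbar, hbar]; exact hx y).1
  have hΔ : ∀ l, P.Delta l ≤ κ * δ := by
    intro l
    have h1 := (div_lt_iff₀ hδ).1 (hκ l)
    have h2 : P.Delta l ≤ -P.zeta δ bmax l := by
      rw [zeta, neg_mul, neg_div, neg_neg, le_div_iff₀ (Real.exp_pos _), mul_comm]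
      refine mul_le_mul_of_nonneg_right (Real.exp_le_exp.2 ?_) (hP.delta_nonneg l)
      nlinarith
    exact h2.trans h1.le
  rw [(hasDerivAt_weightedBarrier hw hη x t).deriv, neg_div, neg_le_neg_iff,
    div_le_iff₀ (expSum_pos hw)]
  calc ∑ l, w l * Real.exp (-P.η * P.taskBarrier l x t) * (P.Delta l * Real.exp (-P.rate l * t))
      ≤ ∑ l, w l * Real.exp (-P.η * P.taskBarrier l x t) * (κ * δ) := by
        refine Finset.sum_le_sum fun l _ => mul_le_mul_of_nonneg_left ?_
          (mul_nonneg (hw l) (Real.exp_pos _).le)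
        refine (mul_le_of_le_one_right (hP.delta_nonneg l) (Real.exp_le_one_iff.2 ?_)).trans (hΔ l)
        nlinarith [mul_nonneg (hP.rate_nonneg l) ht0]
    _ = (κ * δ) * ∑ l, w l * Real.exp (-P.η * P.taskBarrier l x t) := by
        rw [← Finset.sum_mul, mul_comm]
    _ ≤ (κ * P.weightedBarrier ε w x t) * P.expSum ε w x t := by
        refine mul_le_mul (by gcongr) (le_add_of_nonneg_right (Real.exp_pos _).le)
          (Finset.sum_nonneg fun l _ => mul_nonneg (hw l) (Real.exp_pos _).le) ?_
        exact mul_nonneg hκpos.le (hδ.le.trans hδx)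

end Regularity

/-! ### Linear inequalities for Filippov velocities -/

/-- A linear inequality for the vector field near `x` passes to the Filippov velocities at `x`, if
its coefficients are continuous at `x`: it describes a closed half-space at `x`. -/
theorem le_apply_of_mem_filippovMap {X : Type} [NormedAddCommGroup X] [InnerProductSpace ℝ X]
    [FiniteDimensional ℝ X] [MeasurableSpace X] [BorelSpace X] {F : X → ℝ → X} {x v : X} {t : ℝ}
    (hv : v ∈ filippovMap F x t) {A : X → X →L[ℝ] ℝ} {c : X → ℝ} (hA : ContinuousAt A x)
    (hc : ContinuousAt c x) (h : ∀ᶠ y in 𝓝 x, c y ≤ A y (F y t)) : c x ≤ A x v := by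
  -- The inequality holds on a whole neighbourhood, so no null set has to be excluded.
  have hv' := mem_iInter₂.1 hv ∅ measure_empty
  refine closedConvexHull_min (t := {u | c x ≤ A x u}) ?_ ?_ ?_ hv'
  · rintro u ⟨y, hy, -, hu⟩
    have hAu : Tendsto (fun i => A (y i) (F (y i) t)) atTop (𝓝 (A x u)) :=
      (isBoundedBilinearMap_apply.continuous.tendsto (A x, u)).comp
        ((hA.tendsto.comp hy).prodMk_nhds hu)
    exact le_of_tendsto_of_tendsto (hc.tendsto.comp hy) hAu (hy.eventually h)
  · exact convex_halfSpace_ge (A x).isLinear _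
  · exact isClosed_le continuous_const (A x).continuous

/-! ### The control law in a group -/

section Group

variable {M K : ℕ}

/-- The projection `x ↦ x̄_k` as a continuous linear map. -/
noncomputable def groupStateCLM (n : Fin M → ℕ) (grp : Fin M → Fin K) (k : Fin K) :
    FullState n →L[ℝ] GroupState n grp k :=
  LinearMap.toContinuousLinearMap
    { toFun := groupState grp k
      map_add' := fun _ _ => rfl
      map_smul' := fun _ _ => rfl }

namespace MultiAgentSystem

variable {S : MultiAgentSystem M} {grp : Fin M → Fin K}

theorem one_le_nHat (i : Fin M) (hi : S.n i ≠ 0) : 1 ≤ S.nHat grp (grp i) := by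
  unfold nHat
  rw [Real.one_le_sqrt]
  have h1 : 1 ≤ ∑ d : {d : Fin M // grp d = grp i}, S.n d :=
    (Nat.one_le_iff_ne_zero.2 hi).trans
      (Finset.single_le_sum (f := fun d : {d : Fin M // grp d = grp i} => S.n d)
        (fun _ _ => Nat.zero_le _) (Finset.mem_univ ⟨i, rfl⟩))
  have h2 : 1 ≤ Finset.univ.sup S.n :=
    (Nat.one_le_iff_ne_zero.2 hi).trans (Finset.le_sup (Finset.mem_univ i))
  exact one_le_mul_of_one_le_of_one_le (by exact_mod_cast h1) (by exact_mod_cast h2)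

/-- The term `‖∂𝔟/∂x_i‖ n̂ C` in the constraint dominates the coupling `c_i`: `n̂ ≥ 1` unless
`n_i = 0`, and then `∂𝔟/∂x_i = 0`. -/
theorem neg_loadShare_mul_le_inner (hS : S.Admissible) {B : ∀ k, GroupState S.n grp k → ℝ → ℝ}
    {α : Fin K → ℝ → ℝ} {u : S.Control grp} {y : FullState S.n} {t : ℝ} (ht : 0 ≤ t) {k : Fin K}
    (i : {i : Fin M // grp i = k})
    (hu : u i (groupState grp (grp i) y) t ∈
      S.qpFeasible grp i (B (grp i)) (α (grp i)) (groupState grp (grp i) y) t) :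
    -(loadShare (B k) (groupState grp k y) t i *
        (deriv (fun τ => B k (groupState grp k y) τ) t + α k (B k (groupState grp k y) t))) ≤
      inner ℝ (partialGrad (B k) (groupState grp k y) t i)
        (groupState grp k (S.closedLoop grp u y t) i) := by
  obtain ⟨i, rfl⟩ := i
  set p := partialGrad (B (grp i)) (groupState grp (grp i) y) t ⟨i, rfl⟩ with hp
  have hcl : groupState grp (grp i) (S.closedLoop grp u y t) ⟨i, rfl⟩ =
      S.f i (y i) t + S.input i (y i) t (u i (groupState grp (grp i) y) t) + S.c i y t := rfl
  rw [hcl, inner_add_right]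
  have hc : -(‖p‖ * S.C) ≤ inner ℝ p (S.c i y t) :=
    (neg_le_neg (mul_le_mul_of_nonneg_left (hS.c_bound i y t ht) (norm_nonneg _))).trans
      (neg_le_of_abs_le (abs_real_inner_le_norm _ _))
  have hn : ‖p‖ * S.C ≤ ‖p‖ * S.nHat grp (grp i) * S.C := by
    by_cases h : S.n i = 0
    · have : IsEmpty (Fin (S.n i)) := by rw [h]; infer_instance
      have hp0 : p = 0 := Subsingleton.elim _ _
      simp [hp0]
    · rw [mul_right_comm]
      exact le_mul_of_one_le_right (mul_nonneg (norm_nonneg _) hS.C_nonneg) (one_le_nHat i h)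
  have hu' : ‖p‖ * S.nHat grp (grp i) * S.C -
      loadShare (B (grp i)) (groupState grp (grp i) y) t ⟨i, rfl⟩ *
        (deriv (fun τ => B (grp i) (groupState grp (grp i) y) τ) t +
          α (grp i) (B (grp i) (groupState grp (grp i) y) t)) ≤
      inner ℝ p (S.f i (y i) t + S.input i (y i) t (u i (groupState grp (grp i) y) t)) := hu
  linarith

/-- Away from the critical points of `B`, the load shares add up to `1`, and the constraints of the
agents add up to the barrier inequality of the group. -/
theorem neg_add_le_fderiv_closedLoop (hS : S.Admissible)
    {B : ∀ k, GroupState S.n grp k → ℝ → ℝ} {α : Fin K → ℝ → ℝ} {u : S.Control grp}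
    {y : FullState S.n} {t : ℝ} (ht : 0 ≤ t) {k : Fin K}
    (hu : ∀ i, grp i = k → u i (groupState grp (grp i) y) t ∈
      S.qpFeasible grp i (B (grp i)) (α (grp i)) (groupState grp (grp i) y) t)
    (hB : fderiv ℝ (fun z => B k z t) (groupState grp k y) ≠ 0) :
    -(deriv (fun τ => B k (groupState grp k y) τ) t + α k (B k (groupState grp k y) t)) ≤
      fderiv ℝ (fun z => B k z t) (groupState grp k y)
        (groupState grp k (S.closedLoop grp u y t)) := by
  have hsum : ∑ d, ‖partialGrad (B k) (groupState grp k y) t d‖ ≠ 0 := by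
    intro h0
    rw [Finset.sum_eq_zero_iff_of_nonneg fun _ _ => norm_nonneg _] at h0
    have hgrad : gradient (fun z => B k z t) (groupState grp k y) = 0 := by
      ext1 d
      exact norm_eq_zero.1 (h0 d (Finset.mem_univ d))
    rw [gradient, LinearIsometryEquiv.map_eq_zero_iff] at hgrad
    exact hB hgrad
  have hshare : ∑ i, loadShare (B k) (groupState grp k y) t i = 1 := by
    simp only [loadShare, if_pos hsum]
    rw [← Finset.sum_div, div_self hsum]
  rw [← inner_gradient_left, PiLp.inner_apply, ← one_mul (_ + _), ← hshare, Finset.sum_mul,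
    ← Finset.sum_neg_distrib]
  exact Finset.sum_le_sum fun i _ => neg_loadShare_mul_le_inner hS ht i (hu i i.2)

end MultiAgentSystem

end Group

/-! ### The barrier inequality along Filippov solutions -/

section Partial

variable {E : Type} [NormedAddCommGroup E] [NormedSpace ℝ E] {B : E → ℝ → ℝ} {x : E} {t : ℝ}

theorem hasFDerivAt_left_of_differentiableAt
    (h : DifferentiableAt ℝ (fun q : E × ℝ => B q.1 q.2) (x, t)) :
    HasFDerivAt (fun y => B y t)
      ((fderiv ℝ (fun q : E × ℝ => B q.1 q.2) (x, t)).comp (ContinuousLinearMap.inl ℝ E ℝ)) x :=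
  HasFDerivAt.comp (g := fun q : E × ℝ => B q.1 q.2) (f := fun y => (y, t)) x h.hasFDerivAt
    (hasFDerivAt_prodMk_left x t)

theorem hasDerivAt_right_of_differentiableAt
    (h : DifferentiableAt ℝ (fun q : E × ℝ => B q.1 q.2) (x, t)) :
    HasDerivAt (fun τ => B x τ) (fderiv ℝ (fun q : E × ℝ => B q.1 q.2) (x, t) (0, 1)) t :=
  HasFDerivAt.comp_hasDerivAt (l := fun q : E × ℝ => B q.1 q.2) t h.hasFDerivAt
    ((hasDerivAt_const t x).prodMk (hasDerivAt_id t))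

theorem hasDerivAt_comp_of_differentiableAt {y : ℝ → E} {v : E}
    (h : DifferentiableAt ℝ (fun q : E × ℝ => B q.1 q.2) (y t, t)) (hy : HasDerivAt y v t) :
    HasDerivAt (fun τ => B (y τ) τ) (fderiv ℝ (fun q : E × ℝ => B q.1 q.2) (y t, t) (v, 1)) t :=
  HasFDerivAt.comp_hasDerivAt (l := fun q : E × ℝ => B q.1 q.2) (f := fun τ => (y τ, τ)) t
    h.hasFDerivAt (hy.prodMk (hasDerivAt_id t))

end Partial

/-- The barrier inequality along a Filippov solution, for a function `B` that agrees with the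
barrier function `𝔅 k` near the time `t`. Away from the critical points of `B` it follows from the
control law; at the critical points, it has to be assumed. -/
theorem MultiAgentSystem.neg_mul_le_deriv_comp {M K : ℕ} {S : MultiAgentSystem M}
    (hS : S.Admissible) {grp : Fin M → Fin K} {k : Fin K}
    {𝔅 : ∀ k, GroupState S.n grp k → ℝ → ℝ} {B : GroupState S.n grp k → ℝ → ℝ} {κ : Fin K → ℝ}
    {D : Set (GroupState S.n grp k)} (hD : IsOpen D) {u : S.Control grp} {t : ℝ} (ht : 0 ≤ t)
    (hB : ∀ᶠ τ in 𝓝 t, ∀ z, 𝔅 k z τ = B z τ)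
    (hu : ∀ i, grp i = k → ∀ y : FullState S.n, groupState grp k y ∈ D →
      DifferentiableAt ℝ (fun z => 𝔅 k z t) (groupState grp k y) →
        u i (groupState grp (grp i) y) t ∈
          S.qpFeasible grp i (𝔅 (grp i)) (fun s => κ (grp i) * s) (groupState grp (grp i) y) t)
    {x : ℝ → FullState S.n} {v : FullState S.n}
    (hv : v ∈ filippovMap (S.closedLoop grp u) (x t) t) (hxv : HasDerivAt x v t)
    (hxD : groupState grp k (x t) ∈ D)
    (hsmooth : ContDiffAt ℝ 1 (fun q : GroupState S.n grp k × ℝ => B q.1 q.2)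
      (groupState grp k (x t), t))
    (hcrit : HasFDerivAt (fun z => B z t) (0 : GroupState S.n grp k →L[ℝ] ℝ)
        (groupState grp k (x t)) →
      -(κ k * B (groupState grp k (x t)) t) ≤ deriv (fun τ => B (groupState grp k (x t)) τ) t) :
    -(κ k * B (groupState grp k (x t)) t) ≤ deriv (fun τ => B (groupState grp k (x τ)) τ) t := by
  have hbar : ∀ z, 𝔅 k z t = B z t := hB.self_of_nhds
  have hbar' : ∀ z, deriv (fun τ => 𝔅 k z τ) t = deriv (fun τ => B z τ) t := fun z =>
    Filter.EventuallyEq.deriv_eq (hB.mono fun τ hτ => hτ z)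
  have hdiff := hsmooth.differentiableAt one_ne_zero
  set Φ' := fderiv ℝ (fun q : GroupState S.n grp k × ℝ => B q.1 q.2) with hΦ'
  have hxbar : HasDerivAt (fun τ => groupState grp k (x τ)) (groupState grp k v) t :=
    (groupStateCLM S.n grp k).hasFDerivAt.comp_hasDerivAt t hxv
  have hchain := hasDerivAt_comp_of_differentiableAt
    (y := fun τ => groupState grp k (x τ)) hdiff hxbar
  have hsplit : Φ' (groupState grp k (x t), t) (groupState grp k v, 1) =
      Φ' (groupState grp k (x t), t) (groupState grp k v, 0) +
        Φ' (groupState grp k (x t), t) (0, 1) := by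
    rw [← map_add]; simp
  rw [hchain.deriv, ← hΦ', hsplit]
  by_cases hcomp : (Φ' (groupState grp k (x t), t)).comp
      (ContinuousLinearMap.inl ℝ (GroupState S.n grp k) ℝ) = 0
  · have h1 : Φ' (groupState grp k (x t), t) (groupState grp k v, 0) = 0 :=
      DFunLike.congr_fun hcomp (groupState grp k v)
    have h2 := hasFDerivAt_left_of_differentiableAt hdiff
    rw [← hΦ', hcomp] at h2
    rw [h1, zero_add, ← (hasDerivAt_right_of_differentiableAt hdiff).deriv]
    exact hcrit h2
  · have hproj : Continuous fun y : FullState S.n => (groupState grp k y, t) :=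
      (groupStateCLM S.n grp k).continuous.prodMk continuous_const
    have hΦ'c : ContinuousAt (fun y : FullState S.n => Φ' (groupState grp k y, t)) (x t) :=
      ContinuousAt.comp (g := Φ') (hsmooth.continuousAt_fderiv one_ne_zero) hproj.continuousAt
    have hΦc : ContinuousAt (fun y : FullState S.n => B (groupState grp k y) t) (x t) :=
      ContinuousAt.comp (g := fun q : GroupState S.n grp k × ℝ => B q.1 q.2)
        (f := fun y : FullState S.n => (groupState grp k y, t)) hdiff.continuousAt
        hproj.continuousAt
    have hA : ContinuousAt (fun y : FullState S.n => (Φ' (groupState grp k y, t)).comp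
        (ContinuousLinearMap.inl ℝ (GroupState S.n grp k) ℝ)) (x t) :=
      hΦ'c.clm_comp continuousAt_const
    have hfil := le_apply_of_mem_filippovMap hv
      (A := fun y => ((Φ' (groupState grp k y, t)).comp
        (ContinuousLinearMap.inl ℝ (GroupState S.n grp k) ℝ)).comp (groupStateCLM S.n grp k))
      (c := fun y => -(Φ' (groupState grp k y, t) (0, 1) + κ k * B (groupState grp k y) t))
      (hA.clm_comp continuousAt_const)
      ((hΦ'c.clm_apply continuousAt_const).add (continuousAt_const.mul hΦc)).neg ?_
    · have hfil' : -(Φ' (groupState grp k (x t), t) (0, 1) + κ k * B (groupState grp k (x t)) t) ≤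
        Φ' (groupState grp k (x t), t) (groupState grp k v, 0) := hfil
      linarith
    · have hevD : ∀ᶠ y in 𝓝 (x t), groupState grp k y ∈ D :=
        (groupStateCLM S.n grp k).continuous.continuousAt.eventually (hD.mem_nhds hxD)
      have hevdiff : ∀ᶠ y in 𝓝 (x t), DifferentiableAt ℝ
          (fun q : GroupState S.n grp k × ℝ => B q.1 q.2) (groupState grp k y, t) :=
        hproj.continuousAt.eventually ((hsmooth.eventually (by simp)).mono fun q hq =>
          hq.differentiableAt one_ne_zero)
      filter_upwards [hevD, hevdiff, hA.eventually_ne hcomp] with y hyD hydiff hyne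
      have hleft := hasFDerivAt_left_of_differentiableAt hydiff
      have hfun : (fun z => 𝔅 k z t) = fun z => B z t := funext hbar
      have hmain := S.neg_add_le_fderiv_closedLoop hS (u := u) (y := y)
        (B := 𝔅) (α := fun k s => κ k * s) ht
        (fun i hi => hu i hi y hyD (by rw [hfun]; exact hleft.differentiableAt))
        (by rw [hfun, hleft.fderiv]; exact hyne)
      rw [hbar', hbar, hfun, hleft.fderiv,
        (hasDerivAt_right_of_differentiableAt hydiff).deriv] at hmain
      exact hmain

/-! ### Invariance and robustness -/

/-- The barrier function stays nonnegative along a state trajectory `y`. By induction over the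
switching times: between two switches, the barrier inequality `hderiv` makes the superlevel set
invariant, and at a switch the barrier function can only increase. -/
theorem BarrierParams.barrier_nonneg_of_le_switchSeq {E : Type} [NormedAddCommGroup E]
    [InnerProductSpace ℝ E] {φ : TemporalFormula E} {P : BarrierParams φ} {ε κ T : ℝ}
    (hC1 : ∀ τ ∈ φ.tasks, ContDiff ℝ 1 τ.h) (hη : 0 < P.η) (hκ : 0 ≤ κ) {D : Set E}
    (hD : IsOpen D)
    (hDC : ∀ t ∈ Ico 0 (φ.switchSeq (Fin.last _)), {x | 0 ≤ P.barrier ε x t} ⊆ D)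
    {y : ℝ → E} (hy : AbsolutelyContinuousOnInterval y 0 T) (hy0 : 0 ≤ P.barrier ε (y 0) 0)
    (hT : ∀ j, φ.switchSeq j ≤ T)
    (hderiv : ∀ᵐ t, t ∈ Ioo 0 T → y t ∈ D → ∀ j : Fin φ.numSwitches,
      t ∈ Ioo (φ.switchSeq j.castSucc) (φ.switchSeq j.succ) →
        -(κ * P.weightedBarrier ε (fun l => φ.switch l (φ.switchSeq j.castSucc)) (y t) t) ≤
          deriv (fun τ => P.weightedBarrier ε
            (fun l => φ.switch l (φ.switchSeq j.castSucc)) (y τ) τ) t)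
    (j : Fin (φ.numSwitches + 1)) :
    ∀ t ∈ Icc 0 (φ.switchSeq j), 0 ≤ P.barrier ε (y t) t := by
  induction j using Fin.induction with
  | zero =>
    intro t ht
    have : t = 0 := le_antisymm ht.2 ht.1
    rwa [this]
  | succ j ih =>
    have hlt := TemporalFormula.switchSeq_strictMono (φ := φ) j.castSucc_lt_succ
    have hnn := TemporalFormula.switchSeq_nonneg (φ := φ) j.castSucc
    have hw : ∀ l, 0 ≤ φ.switch l (φ.switchSeq j.castSucc) := fun l =>
      TemporalFormula.switch_nonneg l _
    have hT0 : 0 ≤ T := hnn.trans (hT _)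
    have hsub : Icc (φ.switchSeq j.castSucc) (φ.switchSeq j.succ) ⊆ Icc 0 T :=
      Icc_subset_Icc hnn (hT _)
    have hyc : ContinuousOn y (Icc 0 T) := by
      simpa [uIcc_of_le hT0] using hy.continuousOn
    have hid : AbsolutelyContinuousOnInterval (fun t : ℝ => t) 0 T :=
      LipschitzWith.id.lipschitzOnWith.absolutelyContinuousOnInterval
    have hb := (locallyLipschitz_weightedBarrier (P := P) (ε := ε) hC1
      hw).comp_absolutelyContinuousOnInterval (hy.prodMk hid)
    have hinv : ∀ t ∈ Icc (φ.switchSeq j.castSucc) (φ.switchSeq j.succ),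
        0 ≤ P.weightedBarrier ε (fun l => φ.switch l (φ.switchSeq j.castSucc)) (y t) t := by
      intro t ht
      refine AbsolutelyContinuousOnInterval.nonneg_of_ae_deriv_ge (D := D) (κ := κ)
        (hb.mono (by simpa only [uIcc_of_le hlt.le, uIcc_of_le hT0] using hsub))
        (hyc.mono hsub) hD hκ (fun s hs hbs => ?_) ?_ ?_ ht
      · refine hDC s ⟨hnn.trans hs.1, hs.2.trans_le
          (TemporalFormula.switchSeq_strictMono.monotone (Fin.le_last _))⟩ ?_
        rw [mem_ofPred_eq, barrier_eq_of_mem_Ico hs]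
        exact hbs
      · filter_upwards [hderiv] with s hs hsI hsD
        exact hs ⟨hnn.trans_lt hsI.1, hsI.2.trans_le (hT _)⟩ hsD j hsI
      · rw [← barrier_eq_of_mem_Ico ⟨le_rfl, hlt⟩]
        exact ih _ ⟨hnn, le_rfl⟩
    intro t ht
    rcases le_or_gt t (φ.switchSeq j.castSucc) with h | h
    · exact ih t ⟨ht.1, h⟩
    · refine (hinv t ⟨h.le, ht.2⟩).trans ?_
      rw [barrier_eq_weightedBarrier]
      exact weightedBarrier_anti (fun l => TemporalFormula.switch_nonneg l _)
        (fun l => TemporalFormula.switch_antitone l h.le) hη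

/-- Nonnegativity of the barrier function before the deadline `b` of an operator gives `r ≤ h` on
`[t*,b]`; the value at `b`, where the operator is already switched off, follows by continuity. -/
theorem BarrierParams.IsFeasible.r_le_of_barrier_nonneg {E : Type} [NormedAddCommGroup E]
    {φ : TemporalFormula E} {P : BarrierParams φ} {ε δ T : ℝ} {y : ℝ → E}
    (hP : P.IsFeasible ε δ (y 0)) (hC1 : ∀ τ ∈ φ.tasks, Continuous τ.h)
    (hy : ContinuousOn y (Icc 0 T))
    (hbar : ∀ t ∈ Icc 0 (φ.switchSeq (Fin.last _)), 0 ≤ P.barrier ε (y t) t)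
    (l : Fin φ.numTasks) (hT : (φ.task l).b ≤ T) {t : ℝ}
    (ht : t ∈ Icc (φ.task l).tStar (φ.task l).b) : P.r ≤ (φ.task l).h (y t) := by
  obtain ⟨ha, hab⟩ := TemporalFormula.nonneg_and_le_of_mem_tasks (TemporalFormula.task_mem l)
  have hstar : 0 ≤ (φ.task l).tStar := by
    unfold STLTask.tStar
    split_ifs
    exacts [ha, ha.trans hab]
  rcases (ha.trans hab).eq_or_lt with hb | hb
  · -- An operator with `b = 0` is never active; the constraint on `γ₀` takes care of it.
    have ht0 : t = 0 := le_antisymm (ht.2.trans hb.ge) (hstar.trans ht.1)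
    have hl := hP.gamma_zero l
    rw [ht0]
    exact (hl.2 (not_lt.2 ((ht.1.trans ht.2).trans hb.ge))).trans hl.1.le
  · obtain ⟨i, hi⟩ := TemporalFormula.exists_switchSeq_eq (TemporalFormula.task_mem l) hb
    have hact : ∀ s ∈ Ico 0 (φ.task l).b, P.gamma l s ≤ (φ.task l).h (y s) := by
      intro s hs
      have h1 := hbar s ⟨hs.1, hs.2.le.trans (by
        rw [← hi]
        exact TemporalFormula.switchSeq_strictMono.monotone (Fin.le_last _))⟩
      have h2 : P.barrier ε (y s) s ≤ P.taskBarrier l (y s) s :=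
        weightedBarrier_le_taskBarrier (fun l => TemporalFormula.switch_nonneg l s) hP.eta_pos
          (if_pos hs.2)
      have h3 := h1.trans h2
      unfold taskBarrier at h3
      linarith
    have hcl : closure (Ico 0 (φ.task l).b) = Icc 0 (φ.task l).b := closure_Ico hb.ne
    refine (hP.r_le_gamma l ht.1).trans
      (le_on_closure hact (contDiff_gamma l).continuous.continuousOn ?_ ?_)
    · rw [hcl]
      exact (hC1 _ (TemporalFormula.task_mem l)).comp_continuousOn
        (hy.mono (Icc_subset_Icc_right hT))
    · rw [hcl]
      exact ⟨hstar.trans ht.1, ht.2⟩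

theorem corollary2 {M K : ℕ} (S : MultiAgentSystem M) (hS : S.Admissible)
    -- the communication graph and the partition of the agents into groups
    (G : SimpleGraph (Fin M)) (grp : Fin M → Fin K)
    (hcom : ∀ k, G.IsClique {i | grp i = k})
    -- the formulas, with continuously differentiable concave predicate functions
    (φ : ∀ k, TemporalFormula (GroupState S.n grp k))
    (hC1 : ∀ k, ∀ τ ∈ (φ k).tasks, ContDiff ℝ 1 τ.h)
    (hconc : ∀ k, ∀ τ ∈ (φ k).tasks, ConcaveOn ℝ univ τ.h)
    -- the initial state and the barrier functions from the parameter selection problem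
    (x₀ : FullState S.n) (ε δ : Fin K → ℝ) (hε : ∀ k, 0 ≤ ε k) (hδ : ∀ k, 0 < δ k)
    (P : ∀ k, BarrierParams (φ k))
    (hP : ∀ k, (P k).IsFeasible (ε k) (δ k) (groupState grp k x₀))
    -- the gain of the linear class K functions
    (bmax κ : Fin K → ℝ) (hbmax : ∀ k, (P k).IsMaxBound (ε k) (bmax k))
    (hκpos : ∀ k, 0 < κ k)
    (hκ : ∀ k l, -(P k).zeta (δ k) (bmax k) l / δ k < κ k)
    -- open sets containing the superlevel sets of the barrier functions
    (𝔇 : ∀ k, Set (GroupState S.n grp k)) (h𝔇 : ∀ k, IsOpen (𝔇 k))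
    (h𝔇C : ∀ k, ∀ t ∈ Ico 0 ((φ k).switchSeq (Fin.last _)),
      {x | 0 ≤ (P k).barrier (ε k) x t} ⊆ 𝔇 k)
    -- the control law, given by the quadratic programs
    (u : S.Control grp)
    (hu : ∀ i, ∀ x ∈ 𝔇 (grp i), ∀ j : Fin (φ (grp i)).numSwitches,
      ∀ t ∈ Ioo ((φ (grp i)).switchSeq j.castSucc) ((φ (grp i)).switchSeq j.succ),
        DifferentiableAt ℝ (fun y => (P (grp i)).barrier (ε (grp i)) y t) x →
          S.IsQPSolution grp i ((P (grp i)).barrier (ε (grp i))) (fun s => κ (grp i) * s)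
            x t (u i x t))
    -- a Filippov solution of the closed-loop system
    (T : ℝ) (hT : 0 ≤ T) (x : ℝ → FullState S.n)
    (hx : IsFilippovSolution (S.closedLoop grp u) x 0 T) (hx₀ : x 0 = x₀)
    -- a group whose tasks end before `T`; differentiability along the solution
    (k : Fin K) (hTk : ∀ τ ∈ (φ k).tasks, τ.b ≤ T)
    (hdiff : ε k = 0 → ∀ᵐ t ∂(volume.restrict (Icc 0 T)), groupState grp k (x t) ≠ 0) :
    0 < (P k).r ∧
      ((P k).r : EReal) ≤ (φ k).robustness (fun t => groupState grp k (x t)) 0 := by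
  refine ⟨(hP k).r_pos, ?_⟩
  have hy : AbsolutelyContinuousOnInterval (fun t => groupState grp k (x t)) 0 T :=
    (groupStateCLM S.n grp k).lipschitz.locallyLipschitz.comp_absolutelyContinuousOnInterval hx.1
  have hT' : ∀ j, (φ k).switchSeq j ≤ T := by
    intro j
    rcases Fin.eq_zero_or_eq_succ j with rfl | ⟨j, rfl⟩
    · exact hT
    · obtain ⟨⟨τ, hτ, hτb⟩, -⟩ :=
        TemporalFormula.mem_switchTimes.1 (TemporalFormula.switchSeq_succ_mem j)
      exact hτb ▸ hTk τ hτ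
  have hPk := hP k
  rw [← hx₀] at hPk
  have hfil := (ae_restrict_iff' measurableSet_Icc).1 hx.2
  have hne : ∀ᵐ t, t ∈ Icc 0 T → ε k ≠ 0 ∨ groupState grp k (x t) ≠ 0 := by
    by_cases hεk : ε k = 0
    · exact ((ae_restrict_iff' measurableSet_Icc).1 (hdiff hεk)).mono fun t h ht => Or.inr (h ht)
    · exact Eventually.of_forall fun t _ => Or.inl hεk
  have hbar := BarrierParams.barrier_nonneg_of_le_switchSeq (P := P k) (ε := ε k) (κ := κ k)
    (hC1 k) (hP k).eta_pos (hκpos k).le (h𝔇 k) (h𝔇C k) hy ((hδ k).le.trans hPk.initial) hT' (by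
      filter_upwards [hfil, hne] with t hfil hne htT htD j ht
      obtain ⟨v, hv, hxv⟩ := hfil (Ioo_subset_Icc_self htT)
      refine S.neg_mul_le_deriv_comp hS (𝔅 := fun k => (P k).barrier (ε k)) (h𝔇 k) htT.1.le
        ?_ ?_ hv hxv htD
        (BarrierParams.contDiffAt_weightedBarrier (hC1 k)
          (fun l => TemporalFormula.switch_nonneg l _) (hne (Ioo_subset_Icc_self htT)) t)
        fun hcrit => ?_
      · filter_upwards [Ioo_mem_nhds ht.1 ht.2] with τ hτ
        exact BarrierParams.barrier_eq_of_mem_Ico (Ioo_subset_Ico_self hτ)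
      · rintro i rfl y hyD hydiff
        exact (hu i _ hyD j t ht hydiff).1
      · exact (hP k).neg_mul_le_deriv_of_isMax (hC1 k) (hδ k) (hbmax k) (hκpos k) (hκ k) j
          (Ioo_subset_Ico_self ht) (BarrierParams.le_of_hasFDerivAt_zero (hconc k)
            (fun l => TemporalFormula.switch_nonneg l _) (hP k).eta_pos hcrit))
    (Fin.last _)
  have hyc : ContinuousOn (fun t => groupState grp k (x t)) (Icc 0 T) := by
    simpa only [uIcc_of_le hT] using hy.continuousOn
  refine TemporalFormula.le_robustness fun τ hτ t ht => ?_
  obtain ⟨l, rfl⟩ := TemporalFormula.exists_task_eq hτ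
  exact hPk.r_le_of_barrier_nonneg (fun τ hτ => (hC1 k τ hτ).continuous) hyc hbar l
    (hTk _ hτ) ht
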